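/- Let $\mathscr{E}$ be the ring of germs at the origin of smooth real functions of $(x,\lambda)\in\mathbb{R}^2$, and $\mathcal{M}=\langle x,\lambda\rangle_{\mathscr{E}}$ its maximal ideal. For $f\in\mathscr{E}$ let $J^\infty(f)$ be its Taylor series at the origin and $\mathrm{Terms}(f)$ the set of the nonzero terms of $J^\infty(f)$; $f$ is flat if $J^\infty(f)=0$. A local order $\prec$ is a strict total order on the monomials $X^\alpha=x^{\alpha_1}\lambda^{\alpha_2}$ such that $X^\alpha\prec X^\beta$ implies $X^{\alpha+\gamma}\prec X^{\beta+\gamma}$, and $x\prec 1$, $\lambda\prec 1$; terms are compared through their monomials, and $0\prec X^\alpha$ for all $\alpha$. For non-flat $f$, $LT(f)$ is the $\prec$-largest term of $f$ and $LC(f)$ is its coefficient; $LT(f)=0$ for flat $f$. The anti-graded lexicographic order is defined by $X^\alpha\prec_{\rm alex}X^\beta$ iff $\deg X^\alpha>\deg X^\beta$, or the degrees are equal and $\alpha_i<\beta_i$ for the first $i$ with $\alpha_i\ne\beta_i$. A finite set $G\subset\mathscr{E}$ is a standard basis of an ideal $I$ if it generates $I$ and $\langle LT(f): f\in I\rangle_{\mathscr{E}}=\langle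 LT(g): g\in G\rangle_{\mathscr{E}}$. It is a reduced standard basis if moreover $LC(g)=1$ for all $g\in G$ and, for all $g,h\in G$, $LT(g)$ divides no $t\in\mathrm{Terms}(h)$, except when $g=h$ and $t=LT(g)$. A remainder of $f\in\mathscr{E}$ with respect to $G$ and $\prec$ is a germ $s=f-\sum_{g\in G}q_g g$ with $q_g\in\mathscr{E}$ and $LT(q_g g)\preceq LT(f)$ for all $g\in G$, such that no term of $s$ is divisible by any $LT(g)$, $g\in G$. A germ is called polynomial if it is the germ of a polynomial in $x,\lambda$. Let $I$ be an ideal of $\mathscr{E}$ of finite codimension, i.e. $\mathcal{M}^k\subseteq I$ for some $k\in\mathbb{N}$. (1) For every local order, $I$ has exactly one reduced standard basis that consists of polynomial germs. Moreover, any two reduced standard bases of $I$ (for the same local order) agree modulo flat germs, i.e. have the same set of Taylor series. (2) Let $G$ be a standard basis of $I$ with respect to $\prec_{\rm alex}$ and let $f\in\mathscr{E}$. Then, among the remainders of $f$ with respect to $G$ and $\prec_{\rm alex}$, there is exactly one polynomial germ, say that of $p$; every remainder of $f$ with respect to $G$ and $\prec_{\rm alex}$ differs from it by a flat germ; and $\deg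 p\le k$ for every $k\ge 0$ with $\mathcal{M}^{k+1}\subseteq I$. -/

import Mathlib

open Filter Topology
open scoped ContDiff

/-- Points `(x, λ)` of the plane: `v 0 = x` is the state variable, `v 1 = λ` the parameter. -/
abbrev Plane : Type := Fin 2 → ℝ

/-- Exponents `α` of the monomials `X^α = x ^ α 0 * λ ^ α 1`. -/
abbrev Expo : Type := Fin 2 →₀ ℕ

/-- The ring `𝓔` of germs at the origin of real functions that are smooth near the origin. -/
def smoothGerms : Subring (Germ (𝓝 (0 : Plane)) ℝ) where
  carrier := {u | ∃ f : Plane → ℝ, (∀ᶠ v in 𝓝 (0 : Plane), ContDiffAt ℝ ∞ f v) ∧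
    (f : Germ (𝓝 (0 : Plane)) ℝ) = u}
  mul_mem' := by
    rintro _ _ ⟨f, hf, rfl⟩ ⟨g, hg, rfl⟩
    refine ⟨f * g, ?_, rfl⟩
    filter_upwards [hf, hg] with v h1 h2
    exact h1.mul h2
  add_mem' := by
    rintro _ _ ⟨f, hf, rfl⟩ ⟨g, hg, rfl⟩
    refine ⟨f + g, ?_, rfl⟩
    filter_upwards [hf, hg] with v h1 h2
    exact h1.add h2
  neg_mem' := by
    rintro _ ⟨f, hf, rfl⟩
    refine ⟨-f, ?_, rfl⟩
    filter_upwards [hf] with v h1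
    exact h1.neg
  one_mem' := ⟨fun _ => 1, Eventually.of_forall fun _ => contDiffAt_const, rfl⟩
  zero_mem' := ⟨fun _ => 0, Eventually.of_forall fun _ => contDiffAt_const, rfl⟩

abbrev SmoothGerm : Type := smoothGerms

theorem contDiff_polynomial_eval (p : MvPolynomial (Fin 2) ℝ) :
    ContDiff ℝ ∞ (fun v : Plane => MvPolynomial.eval v p) := by
  induction p using MvPolynomial.induction_on with
  | C a => simpa using contDiff_const
  | add p q hp hq => simpa using hp.add hq
  | mul_X p i hp => simpa using hp.mul (contDiff_apply ℝ ℝ i)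

/-- The germ at the origin of a polynomial function in `(x, λ)`. -/
noncomputable def polyGerm (p : MvPolynomial (Fin 2) ℝ) : SmoothGerm :=
  ⟨((fun v : Plane => MvPolynomial.eval v p : Plane → ℝ) : Germ (𝓝 (0 : Plane)) ℝ),
    ⟨_, Eventually.of_forall fun _ => (contDiff_polynomial_eval p).contDiffAt, rfl⟩⟩

/-- The germ has a polynomial representative. -/
def IsPolynomialGerm (g : SmoothGerm) : Prop := ∃ p, polyGerm p = g

/-- The maximal ideal `M = ⟨x, λ⟩` of `𝓔`. -/
noncomputable def maxIdeal : Ideal SmoothGerm :=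
  Ideal.span {polyGerm (MvPolynomial.X 0), polyGerm (MvPolynomial.X 1)}

def FiniteCodimension (I : Ideal SmoothGerm) : Prop := ∃ k : ℕ, maxIdeal ^ k ≤ I

/-! Taylor expansion at the origin. -/

/-- The partial derivative in the direction of the `i`-th coordinate. -/
noncomputable def partialD (i : Fin 2) (f : Plane → ℝ) : Plane → ℝ :=
  fun v => fderiv ℝ f v (Pi.single i 1)

theorem partialD_iterate_congr (i : Fin 2) (n : ℕ) {f g : Plane → ℝ}
    (h : f =ᶠ[𝓝 0] g) : (partialD i)^[n] f =ᶠ[𝓝 0] (partialD i)^[n] g := by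
  induction n with
  | zero => exact h
  | succ n ih =>
    rw [Function.iterate_succ_apply', Function.iterate_succ_apply']
    exact (ih.fderiv (𝕜 := ℝ)).mono fun v hv => by simp only [partialD, hv]

/-- The Taylor coefficient `(∂_x ^ i ∂_λ ^ j f) (0) / (i! j!)` for `α = (i, j)`. -/
noncomputable def taylorCoeff (u : SmoothGerm) (α : Expo) : ℝ :=
  Germ.liftOn u.1
    (fun f => (partialD 0)^[α 0] ((partialD 1)^[α 1] f) 0 / (((α 0).factorial : ℝ) * (α 1).factorial))
    (fun _ _ h => by
      simp only [(partialD_iterate_congr 0 (α 0) (partialD_iterate_congr 1 (α 1) h)).eq_of_nhds])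

/-- The infinite jet `J^∞(u)`, as a formal power series. -/
noncomputable def infJet (u : SmoothGerm) : MvPowerSeries (Fin 2) ℝ := fun α => taylorCoeff u α

def IsFlat (u : SmoothGerm) : Prop := infJet u = 0

/-- The set of terms `a_α X^α`, `a_α ≠ 0`, of the Taylor expansion of `f`. -/
def Terms (f : SmoothGerm) : Set SmoothGerm :=
  {t | ∃ α, taylorCoeff f α ≠ 0 ∧ t = polyGerm (MvPolynomial.monomial α (taylorCoeff f α))}

/-! Local orders; `r α β` stands for `X^α ≺ X^β`. -/

structure IsLocalOrder (r : Expo → Expo → Prop) : Prop where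
  strictTotal : IsStrictTotalOrder Expo r
  add_right : ∀ α β γ, r α β → r (α + γ) (β + γ)
  var_lt_one : ∀ i, r (Finsupp.single i 1) 0

/-- Lexicographic order: at the first index where they differ, `α` is smaller than `β`. -/
def lexLT (α β : Expo) : Prop := ∃ i, (∀ j, j < i → α j = β j) ∧ α i < β i

/-- Anti-graded lexicographic order. -/
def alexLT (α β : Expo) : Prop :=
  β.degree < α.degree ∨ (α.degree = β.degree ∧ lexLT α β)

/-- `X^α` is the leading monomial of `f`. -/
def IsLeadExpo (r : Expo → Expo → Prop) (f : SmoothGerm) (α : Expo) : Prop :=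
  taylorCoeff f α ≠ 0 ∧ ∀ β, taylorCoeff f β ≠ 0 → β ≠ α → r β α

open Classical in
/-- The leading term `LT(f)` (which is `0` when `f` is flat). -/
noncomputable def leadTerm (r : Expo → Expo → Prop) (f : SmoothGerm) : SmoothGerm :=
  if h : ∃ α, IsLeadExpo r f α then
    polyGerm (MvPolynomial.monomial h.choose (taylorCoeff f h.choose)) else 0

open Classical in
/-- The leading coefficient `LC(f)` (which is `0` when `f` is flat). -/
noncomputable def leadCoeff (r : Expo → Expo → Prop) (f : SmoothGerm) : ℝ :=
  if h : ∃ α, IsLeadExpo r f α then taylorCoeff f h.choose else 0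

/-- `LT(h) ≼ LT(f)`: terms are compared through their monomials, and `0 ≺ X^α` for all `α`. -/
def LeadLE (r : Expo → Expo → Prop) (h f : SmoothGerm) : Prop :=
  ∀ α, IsLeadExpo r h α → ∃ β, IsLeadExpo r f β ∧ (α = β ∨ r α β)

/-- `LT(I)`, the ideal of `𝓔` generated by the leading terms of the elements of `I`. -/
noncomputable def leadIdeal (r : Expo → Expo → Prop) (I : Ideal SmoothGerm) : Ideal SmoothGerm :=
  Ideal.span {t | ∃ f ∈ I, t = leadTerm r f}

structure IsStandardBasis (r : Expo → Expo → Prop) (I : Ideal SmoothGerm)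
    (G : Finset SmoothGerm) : Prop where
  span_eq : Ideal.span (G : Set SmoothGerm) = I
  leadIdeal_eq : leadIdeal r I = Ideal.span {t | ∃ g ∈ G, t = leadTerm r g}

structure IsReducedStandardBasis (r : Expo → Expo → Prop) (I : Ideal SmoothGerm)
    (G : Finset SmoothGerm) : Prop extends IsStandardBasis r I G where
  leadCoeff_eq_one : ∀ g ∈ G, leadCoeff r g = 1
  reduced : ∀ g ∈ G, ∀ h ∈ G, ∀ t ∈ Terms h,
    ¬ (g = h ∧ t = leadTerm r g) → ¬ leadTerm r g ∣ t

/-- `s` is a remainder of `f` with respect to the finite set `G` and the order `r`. -/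
def IsRemainder (r : Expo → Expo → Prop) (f : SmoothGerm) (G : Finset SmoothGerm)
    (s : SmoothGerm) : Prop :=
  (∃ q : SmoothGerm → SmoothGerm,
    (∀ g ∈ G, LeadLE r (q g * g) f) ∧ s = f - ∑ g ∈ G, q g * g) ∧
  ∀ t ∈ Terms s, ∀ g ∈ G, ¬ leadTerm r g ∣ t

/-! Partial derivatives of smooth functions. -/

/-! By Hadamard's lemma `maxIdeal ^ n` is exactly the ideal of germs whose Taylor coefficients of
degree below `n` vanish (`maxIdeal_pow_eq`). Since `I` contains such a power, division by elements
of `I` need only be carried out on the finitely many monomials of degree below a bound, where it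
terminates for every local order and leaves a polynomial remainder with no term in LT(I)
(`exists_normalForm`).

Uniqueness rests on one remark: an element of `I` with no exponent in LT(I) has no leading exponent,
hence is flat (`isFlat_of_forall_notMem_leadExpos`). It applies to the difference of two remainders
of one germ, and to the difference of two reduced basis elements with the same leading monomial. A
polynomial is determined by its Taylor series, so polynomial representatives are unique.

The reduced basis consists of `X^β` minus its normal form, for the finitely many minimal `β` in
LT(I). That it generates `I` is Nakayama's lemma (`CoversLeadExpos.span_eq`).

In (2), the error left by truncated division lies in `maxIdeal ^ m * I`, so it is a combination of
`G` with coefficients in `maxIdeal ^ m`. For a degree-compatible order and `m` large this respects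
the bound on leading terms. If `f` is flat, the quotients can be taken flat
(`flatIdeal_le_maxIdeal_pow_mul`). -/

theorem contDiff_partialD {f : Plane → ℝ} (hf : ContDiff ℝ ∞ f) (i : Fin 2) :
    ContDiff ℝ ∞ (partialD i f) := by
  have := hf.fderiv_right (m := ∞) (by simp)
  exact this.clm_apply contDiff_const

theorem contDiff_partialD_iterate {f : Plane → ℝ} (hf : ContDiff ℝ ∞ f) (i : Fin 2) (n : ℕ) :
    ContDiff ℝ ∞ ((partialD i)^[n] f) := by
  induction n with
  | zero => exact hf
  | succ n ih => rw [Function.iterate_succ_apply']; exact contDiff_partialD ih i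

theorem partialD_add {f g : Plane → ℝ} (hf : ContDiff ℝ ∞ f) (hg : ContDiff ℝ ∞ g) (i : Fin 2) :
    partialD i (f + g) = partialD i f + partialD i g := by
  ext v
  simp [partialD, fderiv_add (hf.differentiable (by simp) v) (hg.differentiable (by simp) v)]

theorem partialD_mul {f g : Plane → ℝ} (hf : ContDiff ℝ ∞ f) (hg : ContDiff ℝ ∞ g) (i : Fin 2) :
    partialD i (f * g) = f * partialD i g + partialD i f * g := by
  ext v
  simp [partialD, fderiv_mul (hf.differentiable (by simp) v) (hg.differentiable (by simp) v)]
  ring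

theorem partialD_comm {f : Plane → ℝ} (hf : ContDiff ℝ ∞ f) (i j : Fin 2) :
    partialD i (partialD j f) = partialD j (partialD i f) := by
  have key : ∀ (i j : Fin 2) (v : Plane), partialD i (partialD j f) v =
      fderiv ℝ (fderiv ℝ f) v (Pi.single i 1) (Pi.single j 1) := by
    intro i j v
    have hd : DifferentiableAt ℝ (fderiv ℝ f) v :=
      (hf.fderiv_right (m := ∞) (by simp)).differentiable (by simp) v
    change fderiv ℝ (fun w => fderiv ℝ f w (Pi.single j 1)) v (Pi.single i 1) = _
    rw [fderiv_clm_apply hd (differentiableAt_const _)]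
    simp
  ext v
  rw [key, key]
  exact (hf.contDiffAt (x := v)).isSymmSndFDerivAt (by
    rw [minSmoothness_of_isRCLikeNormedField]
    exact WithTop.coe_le_coe.2 (le_top (a := (2 : ℕ∞)))) _ _

theorem partialD_iterate_comm {f : Plane → ℝ} (hf : ContDiff ℝ ∞ f) (i j : Fin 2) (n : ℕ) :
    (partialD i)^[n] (partialD j f) = partialD j ((partialD i)^[n] f) := by
  induction n with
  | zero => rfl
  | succ n ih =>
    rw [Function.iterate_succ_apply', ih, partialD_comm (contDiff_partialD_iterate hf i n),
      Function.iterate_succ_apply']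

theorem partialD_const (c : ℝ) (i : Fin 2) : partialD i (fun _ => c) = fun _ => 0 := by
  ext v
  simp [partialD]

theorem partialD_coord (i j : Fin 2) :
    partialD i (fun v => v j) = fun _ => (Pi.single i 1 : Plane) j := by
  ext v
  have : HasFDerivAt (fun v : Plane => v j) (ContinuousLinearMap.proj j : Plane →L[ℝ] ℝ) v :=
    (ContinuousLinearMap.proj j : Plane →L[ℝ] ℝ).hasFDerivAt
  simp [partialD, this.fderiv]

/-! The Taylor series of a function. -/

/-- The Taylor series at the origin of a function on the plane. -/
noncomputable def taylorSeries (f : Plane → ℝ) : MvPowerSeries (Fin 2) ℝ := fun α =>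
  (partialD 0)^[α 0] ((partialD 1)^[α 1] f) 0 / (((α 0).factorial : ℝ) * (α 1).factorial)

theorem coeff_taylorSeries (f : Plane → ℝ) (α : Expo) :
    MvPowerSeries.coeff α (taylorSeries f) =
      (partialD 0)^[α 0] ((partialD 1)^[α 1] f) 0 /
        (((α 0).factorial : ℝ) * (α 1).factorial) := rfl

/-- Makes identities between Taylor series provable by formal differentiation, with no explicit
formula for higher derivatives of a product. -/
theorem pderiv_taylorSeries {f : Plane → ℝ} (hf : ContDiff ℝ ∞ f) (i : Fin 2) :
    MvPowerSeries.pderiv ℝ i (taylorSeries f) = taylorSeries (partialD i f) := by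
  ext α
  rw [MvPowerSeries.coeff_pderiv, coeff_taylorSeries, coeff_taylorSeries]
  have h0 : ((α 0).factorial : ℝ) ≠ 0 := by positivity
  have h1 : ((α 1).factorial : ℝ) ≠ 0 := by positivity
  have h2 : (α 0 : ℝ) + 1 ≠ 0 := by positivity
  have h3 : (α 1 : ℝ) + 1 ≠ 0 := by positivity
  fin_cases i
  · simp only [Fin.zero_eta, Finsupp.coe_add, Pi.add_apply, Finsupp.single_eq_same, ne_eq,
      not_false_eq_true, one_ne_zero, Finsupp.single_eq_of_ne, add_zero,
      Nat.factorial_succ, Nat.cast_mul, Nat.cast_add, Nat.cast_one]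
    rw [partialD_iterate_comm hf 1 0, ← Function.iterate_succ_apply]
    field_simp
  · simp only [Fin.mk_one, Finsupp.coe_add, Pi.add_apply, Finsupp.single_eq_same, ne_eq,
      zero_ne_one, not_false_eq_true, Finsupp.single_eq_of_ne, add_zero,
      Nat.factorial_succ, Nat.cast_mul, Nat.cast_add, Nat.cast_one]
    rw [← Function.iterate_succ_apply]
    field_simp

theorem constantCoeff_taylorSeries (f : Plane → ℝ) :
    MvPowerSeries.coeff 0 (taylorSeries f) = f 0 := by
  simp [coeff_taylorSeries]

theorem partialD_iterate_add {f g : Plane → ℝ} (hf : ContDiff ℝ ∞ f) (hg : ContDiff ℝ ∞ g)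
    (i : Fin 2) (n : ℕ) :
    (partialD i)^[n] (f + g) = (partialD i)^[n] f + (partialD i)^[n] g := by
  induction n with
  | zero => rfl
  | succ n ih =>
    simp only [Function.iterate_succ_apply', ih]
    exact partialD_add (contDiff_partialD_iterate hf i n) (contDiff_partialD_iterate hg i n) i

theorem taylorSeries_add {f g : Plane → ℝ} (hf : ContDiff ℝ ∞ f) (hg : ContDiff ℝ ∞ g) :
    taylorSeries (f + g) = taylorSeries f + taylorSeries g := by
  ext α
  rw [map_add, coeff_taylorSeries, coeff_taylorSeries, coeff_taylorSeries,
    partialD_iterate_add hf hg, partialD_iterate_add (contDiff_partialD_iterate hf _ _)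
      (contDiff_partialD_iterate hg _ _), Pi.add_apply, add_div]

theorem exists_eq_add_single_of_ne_zero {α : Expo} (h : α ≠ 0) :
    ∃ β i, α = β + Finsupp.single i 1 := by
  obtain ⟨i, hi⟩ := Finsupp.ne_iff.1 h
  refine ⟨α - Finsupp.single i 1, i, ?_⟩
  rw [tsub_add_cancel_of_le]
  rw [Finsupp.single_le_iff]
  exact Nat.one_le_iff_ne_zero.2 hi

/-- Induction on the degree: up to the nonzero factor `β i + 1`, the coefficient at `β + e_i` is
that of the `i`-th derivative at `β`, and both sides obey the product rule. -/
theorem taylorSeries_mul {f g : Plane → ℝ} (hf : ContDiff ℝ ∞ f) (hg : ContDiff ℝ ∞ g) :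
    taylorSeries (f * g) = taylorSeries f * taylorSeries g := by
  suffices ∀ n : ℕ, ∀ α : Expo, α.degree = n → ∀ f g : Plane → ℝ, ContDiff ℝ ∞ f →
      ContDiff ℝ ∞ g → MvPowerSeries.coeff α (taylorSeries (f * g)) =
        MvPowerSeries.coeff α (taylorSeries f * taylorSeries g) by
    ext α
    exact this _ α rfl f g hf hg
  intro n
  induction n with
  | zero =>
    intro α hα f g hf hg
    obtain rfl := (Finsupp.degree_eq_zero_iff α).1 hα
    rw [MvPowerSeries.coeff_zero_eq_constantCoeff_apply (taylorSeries f * taylorSeries g), map_mul]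
    simp only [← MvPowerSeries.coeff_zero_eq_constantCoeff_apply, constantCoeff_taylorSeries,
      Pi.mul_apply]
  | succ n ih =>
    intro α hα f g hf hg
    obtain ⟨β, i, rfl⟩ := exists_eq_add_single_of_ne_zero (α := α) (by rintro rfl; simp at hα)
    have hβ : β.degree = n := by
      rw [map_add, Finsupp.degree_single] at hα
      omega
    have h2 : (β i : ℝ) + 1 ≠ 0 := by positivity
    refine mul_right_cancel₀ h2 ?_
    rw [← MvPowerSeries.coeff_pderiv, ← MvPowerSeries.coeff_pderiv,
      pderiv_taylorSeries (show ContDiff ℝ ∞ (f * g) from hf.mul hg), partialD_mul hf hg, Derivation.leibniz,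
      taylorSeries_add (f := f * partialD i g) (g := partialD i f * g)
        (hf.mul (contDiff_partialD hg i)) ((contDiff_partialD hf i).mul hg),
      map_add, map_add, ih β hβ _ _ hf (contDiff_partialD hg i),
      ih β hβ _ _ (contDiff_partialD hf i) hg, pderiv_taylorSeries hf, pderiv_taylorSeries hg,
      smul_eq_mul, smul_eq_mul, mul_comm (taylorSeries g)]

theorem taylorSeries_const (c : ℝ) : taylorSeries (fun _ => c) = MvPowerSeries.C c := by
  -- Additivity applied to `0 + 0 = 0`; the derivatives of a constant are then known to have zero
  -- series.
  have h0 : taylorSeries (fun _ => (0 : ℝ)) = 0 := by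
    have h := taylorSeries_add (f := fun _ => 0) (g := fun _ => 0) contDiff_const contDiff_const
    have h' : ((fun _ => 0) + (fun _ => 0) : Plane → ℝ) = fun _ => 0 := by ext; simp
    rw [h'] at h
    simpa using h
  refine MvPowerSeries.pderiv.ext (fun i => ?_) ?_
  · rw [pderiv_taylorSeries contDiff_const, partialD_const, h0, MvPowerSeries.pderiv_C]
  · rw [← MvPowerSeries.coeff_zero_eq_constantCoeff_apply, constantCoeff_taylorSeries]
    simp

theorem taylorSeries_coord (j : Fin 2) :
    taylorSeries (fun v => v j) = MvPowerSeries.X j := by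
  refine MvPowerSeries.pderiv.ext (fun i => ?_) ?_
  · rw [pderiv_taylorSeries (contDiff_apply ℝ ℝ j), partialD_coord, taylorSeries_const]
    by_cases h : i = j
    · subst h; simp
    · rw [MvPowerSeries.pderiv_X_of_ne (Ne.symm h), Pi.single_eq_of_ne (Ne.symm h), map_zero]
  · rw [← MvPowerSeries.coeff_zero_eq_constantCoeff_apply, constantCoeff_taylorSeries]
    simp

/-! Parametric integrals `∫₀¹ tᵐ g(tv) dt`. -/

/-- The weight `t ^ m` makes the family stable under differentiation: each derivative in `v` brings
out one more factor `t`. -/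
noncomputable def radialMean (m : ℕ) (g : Plane → ℝ) : Plane → ℝ :=
  fun v => ∫ t in (0 : ℝ)..1, t ^ m * g (t • v)

theorem hasFDerivAt_radialMean {g : Plane → ℝ} (hg : ContDiff ℝ ∞ g) (m : ℕ) (v : Plane) :
    HasFDerivAt (radialMean m g) (∫ t in (0 : ℝ)..1, t ^ (m + 1) • fderiv ℝ g (t • v)) v := by
  have hc' : Continuous (fderiv ℝ g) := hg.continuous_fderiv (by simp)
  have hF' : Continuous (fun p : Plane × ℝ => p.2 ^ (m + 1) • fderiv ℝ g (p.2 • p.1)) := by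
    fun_prop
  have hgc := hg.continuous
  -- The dominating function is constant: a bound for the derivative on the compact set (unit ball
  -- around `v`) × [0, 1].
  obtain ⟨C, hC⟩ := ((isCompact_closedBall v 1).prod (isCompact_Icc (a := (0 : ℝ)) (b := 1))
    ).exists_bound_of_continuousOn hF'.continuousOn
  refine intervalIntegral.hasFDerivAt_integral_of_dominated_of_fderiv_le
    (F' := fun v t => t ^ (m + 1) • fderiv ℝ g (t • v)) (bound := fun _ => C)
    (Metric.closedBall_mem_nhds v one_pos) ?_ ?_ ?_ ?_ ?_ ?_
  · refine Eventually.of_forall fun w => Continuous.aestronglyMeasurable ?_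
    fun_prop
  · refine Continuous.intervalIntegrable ?_ _ _
    fun_prop
  · refine Continuous.aestronglyMeasurable ?_
    fun_prop
  · refine Eventually.of_forall fun t ht w hw => hC (w, t) ⟨hw, ?_⟩
    rw [Set.uIoc_of_le zero_le_one] at ht
    exact ⟨ht.1.le, ht.2⟩
  · exact intervalIntegrable_const
  · refine Eventually.of_forall fun t _ w _ => ?_
    have h1 : HasFDerivAt g (fderiv ℝ g (t • w)) (t • w) :=
      (hg.differentiable (by simp) _).hasFDerivAt
    have h2 : HasFDerivAt (fun w : Plane => t • w) (t • ContinuousLinearMap.id ℝ Plane) w :=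
      (hasFDerivAt_id w).const_smul t
    have h3 := (h1.comp w h2).const_mul (t ^ m)
    refine h3.congr_fderiv ?_
    ext y
    simp [pow_succ]
    ring

theorem fderiv_radialMean_apply {g : Plane → ℝ} (hg : ContDiff ℝ ∞ g) (m : ℕ) (v y : Plane) :
    fderiv ℝ (radialMean m g) v y = radialMean (m + 1) (fun w => fderiv ℝ g w y) v := by
  have hc' : Continuous (fderiv ℝ g) := hg.continuous_fderiv (by simp)
  rw [(hasFDerivAt_radialMean hg m v).fderiv, ContinuousLinearMap.intervalIntegral_apply]
  · rfl
  · refine Continuous.intervalIntegrable ?_ _ _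
    fun_prop

theorem contDiff_radialMean {g : Plane → ℝ} (hg : ContDiff ℝ ∞ g) (m : ℕ) :
    ContDiff ℝ ∞ (radialMean m g) := by
  rw [contDiff_infty]
  intro n
  induction n generalizing m g with
  | zero =>
    exact contDiff_zero.2 (continuous_iff_continuousAt.2 fun v =>
      (hasFDerivAt_radialMean hg m v).continuousAt)
  | succ n ih =>
    rw [Nat.cast_add, Nat.cast_one, contDiff_succ_iff_fderiv_apply]
    refine ⟨fun v => (hasFDerivAt_radialMean hg m v).differentiableAt, fun h => by simp at h,
      fun y => ?_⟩
    simp_rw [fderiv_radialMean_apply hg]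
    exact ih ((hg.fderiv_right (m := ∞) (by simp)).clm_apply contDiff_const) _

theorem partialD_radialMean {g : Plane → ℝ} (hg : ContDiff ℝ ∞ g) (m : ℕ) (i : Fin 2) :
    partialD i (radialMean m g) = radialMean (m + 1) (partialD i g) :=
  funext fun v => fderiv_radialMean_apply hg m v _

theorem partialD_iterate_radialMean {g : Plane → ℝ} (hg : ContDiff ℝ ∞ g) (m n : ℕ) (i : Fin 2) :
    (partialD i)^[n] (radialMean m g) = radialMean (m + n) ((partialD i)^[n] g) := by
  induction n with
  | zero => rfl
  | succ n ih =>
    rw [Function.iterate_succ_apply', ih,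
      partialD_radialMean (contDiff_partialD_iterate hg i n), Function.iterate_succ_apply']
    rfl

theorem radialMean_apply_zero (g : Plane → ℝ) (m : ℕ) : radialMean m g 0 = g 0 / (m + 1) := by
  simp [radialMean, div_eq_inv_mul]

/-- A monomial of degree `d` is multiplied by `∫₀¹ t ^ d dt`. Hence no new exponents appear, which
gives control over the Hadamard quotients. -/
theorem coeff_taylorSeries_radialMean {g : Plane → ℝ} (hg : ContDiff ℝ ∞ g) (α : Expo) :
    MvPowerSeries.coeff α (taylorSeries (radialMean 0 g)) =
      MvPowerSeries.coeff α (taylorSeries g) / (α.degree + 1) := by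
  have : (α.degree : ℝ) = α 1 + α 0 := by
    rw [Finsupp.degree_eq_sum, Fin.sum_univ_two, add_comm]; push_cast; rfl
  rw [coeff_taylorSeries, coeff_taylorSeries, partialD_iterate_radialMean hg,
    partialD_iterate_radialMean (contDiff_partialD_iterate hg 1 _), radialMean_apply_zero, this]
  push_cast
  rw [zero_add, div_right_comm]

/-- Hadamard's lemma. -/
theorem eq_sum_coord_mul_radialMean {f : Plane → ℝ} (hf : ContDiff ℝ ∞ f) (h0 : f 0 = 0)
    (v : Plane) :
    f v = v 0 * radialMean 0 (partialD 0 f) v + v 1 * radialMean 0 (partialD 1 f) v := by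
  have hc' : Continuous (fderiv ℝ f) := hf.continuous_fderiv (by simp)
  -- Integrate the derivative of `t ↦ f (t • v)` over [0, 1].
  have hd : ∀ t : ℝ, HasDerivAt (fun t : ℝ => f (t • v)) (fderiv ℝ f (t • v) v) t := by
    intro t
    have h1 : HasFDerivAt f (fderiv ℝ f (t • v)) (t • v) :=
      (hf.differentiable (by simp) _).hasFDerivAt
    have h2 : HasDerivAt (fun t : ℝ => t • v) v t := by
      simpa using (hasDerivAt_id t).smul_const v
    exact h1.comp_hasDerivAt t h2
  have h1 := intervalIntegral.integral_eq_sub_of_hasDerivAt (a := 0) (b := 1)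
    (fun t _ => hd t) (Continuous.intervalIntegrable (by fun_prop) _ _)
  have hv : v = v 0 • (Pi.single 0 1 : Plane) + v 1 • (Pi.single 1 1 : Plane) := by
    ext i; fin_cases i <;> simp
  have h2 : ∀ t : ℝ, fderiv ℝ f (t • v) v =
      v 0 * partialD 0 f (t • v) + v 1 * partialD 1 f (t • v) := by
    intro t
    have h := congrArg (fderiv ℝ f (t • v)) hv
    rw [map_add, map_smul, map_smul] at h
    exact h
  have hp : ∀ i, Continuous (partialD i f) := fun i => (contDiff_partialD hf i).continuous
  simp_rw [h2] at h1
  rw [intervalIntegral.integral_add, intervalIntegral.integral_const_mul,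
    intervalIntegral.integral_const_mul] at h1
  · simpa [radialMean, h0] using h1.symm
  · have := hp 0
    exact Continuous.intervalIntegrable (by fun_prop) _ _
  · have := hp 1
    exact Continuous.intervalIntegrable (by fun_prop) _ _

/-! The ring of germs and its Taylor homomorphism. -/

/-- The germ at the origin of a smooth function on the plane. -/
noncomputable def germOf (f : Plane → ℝ) (hf : ContDiff ℝ ∞ f) : SmoothGerm :=
  ⟨(f : Germ (𝓝 (0 : Plane)) ℝ), f, Eventually.of_forall fun _ => hf.contDiffAt, rfl⟩

theorem infJet_germOf {f : Plane → ℝ} (hf : ContDiff ℝ ∞ f) :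
    infJet (germOf f hf) = taylorSeries f := rfl

/-- Every smooth germ has a representative that is smooth on the whole plane. -/
theorem exists_germOf_eq (u : SmoothGerm) : ∃ f, ∃ hf : ContDiff ℝ ∞ f, u = germOf f hf := by
  obtain ⟨_, f, hf, rfl⟩ := u
  obtain ⟨ε, hε, h⟩ := Metric.eventually_nhds_iff_ball.1 hf
  -- The cutoff is 1 on the ball of radius `ε / 3` and supported in that of radius `ε / 2`, well
  -- inside the region where `f` is smooth.
  let χ : ContDiffBump (0 : Plane) := ⟨ε / 3, ε / 2, by positivity, by linarith⟩
  refine ⟨fun v => χ v * f v, ?_, ?_⟩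
  · rw [contDiff_iff_contDiffAt]
    intro v
    by_cases hv : v ∈ Metric.ball (0 : Plane) ε
    · exact χ.contDiff.contDiffAt.mul (h v hv)
    · have hv' : v ∉ tsupport χ := by
        rw [χ.tsupport_eq]
        intro h'
        refine hv (Metric.closedBall_subset_ball ?_ h')
        change ε / 2 < ε
        linarith
      have h0 : χ =ᶠ[𝓝 v] 0 := notMem_tsupport_iff_eventuallyEq.1 hv'
      refine (contDiffAt_const (c := (0 : ℝ))).congr_of_eventuallyEq ?_
      filter_upwards [h0] with w hw
      simp [hw]
  · refine Subtype.ext (Germ.coe_eq.2 ?_)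
    filter_upwards [χ.eventuallyEq_one] with v hv
    simp [hv]

/-- Taylor expansion at the origin, as a ring homomorphism. -/
noncomputable def jet : SmoothGerm →+* MvPowerSeries (Fin 2) ℝ where
  toFun := infJet
  map_one' := taylorSeries_const 1
  map_zero' := (taylorSeries_const 0).trans (map_zero _)
  map_mul' u w := by
    obtain ⟨f, hf, rfl⟩ := exists_germOf_eq u
    obtain ⟨g, hg, rfl⟩ := exists_germOf_eq w
    exact taylorSeries_mul hf hg
  map_add' u w := by
    obtain ⟨f, hf, rfl⟩ := exists_germOf_eq u
    obtain ⟨g, hg, rfl⟩ := exists_germOf_eq w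
    exact taylorSeries_add hf hg

theorem jet_eq_infJet (u : SmoothGerm) : jet u = infJet u := rfl

theorem coeff_jet (u : SmoothGerm) (α : Expo) :
    MvPowerSeries.coeff α (jet u) = taylorCoeff u α := rfl

theorem isFlat_iff {u : SmoothGerm} : IsFlat u ↔ ∀ α, taylorCoeff u α = 0 :=
  ⟨fun h α => congrFun h α, fun h => funext h⟩

theorem taylorCoeff_zero (α : Expo) : taylorCoeff 0 α = 0 := by
  rw [← coeff_jet, map_zero, map_zero]

theorem taylorCoeff_add (u w : SmoothGerm) (α : Expo) :
    taylorCoeff (u + w) α = taylorCoeff u α + taylorCoeff w α := by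
  simp only [← coeff_jet, map_add]

theorem taylorCoeff_sub (u w : SmoothGerm) (α : Expo) :
    taylorCoeff (u - w) α = taylorCoeff u α - taylorCoeff w α := by
  simp only [← coeff_jet, map_sub]

theorem taylorCoeff_mul (u w : SmoothGerm) (α : Expo) :
    taylorCoeff (u * w) α =
      ∑ p ∈ Finset.HasAntidiagonal.antidiagonal α, taylorCoeff u p.1 * taylorCoeff w p.2 := by
  classical
  simp only [← coeff_jet, map_mul, MvPowerSeries.coeff_mul]

/-- The germ of a polynomial, as a ring homomorphism. -/
noncomputable def polyGermHom : MvPolynomial (Fin 2) ℝ →+* SmoothGerm where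
  toFun := polyGerm
  map_one' := Subtype.ext (by simp [polyGerm]; rfl)
  map_zero' := Subtype.ext (by simp [polyGerm]; rfl)
  map_mul' p q := Subtype.ext (by simp [polyGerm]; rfl)
  map_add' p q := Subtype.ext (by simp [polyGerm]; rfl)

theorem jet_polyGerm (p : MvPolynomial (Fin 2) ℝ) :
    jet (polyGerm p) = (p : MvPowerSeries (Fin 2) ℝ) := by
  have : jet.comp polyGermHom = MvPolynomial.coeToMvPowerSeries.ringHom := by
    refine MvPolynomial.ringHom_ext (fun c => ?_) (fun i => ?_)
    · have h : polyGermHom (MvPolynomial.C c) = germOf (fun _ => c) contDiff_const :=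
        Subtype.ext (by simp [polyGermHom, polyGerm, germOf])
      rw [RingHom.comp_apply, h, jet_eq_infJet, infJet_germOf, taylorSeries_const]
      simp
    · have h : polyGermHom (MvPolynomial.X i) = germOf (fun v => v i) (contDiff_apply ℝ ℝ i) :=
        Subtype.ext (by simp [polyGermHom, polyGerm, germOf])
      rw [RingHom.comp_apply, h, jet_eq_infJet, infJet_germOf, taylorSeries_coord]
      simp
  exact congrArg (fun φ => φ p) this

theorem taylorCoeff_polyGerm (p : MvPolynomial (Fin 2) ℝ) (α : Expo) :
    taylorCoeff (polyGerm p) α = p.coeff α := by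
  rw [← coeff_jet, jet_polyGerm, MvPolynomial.coeff_coe]

theorem polyGerm_add (p q : MvPolynomial (Fin 2) ℝ) :
    polyGerm (p + q) = polyGerm p + polyGerm q := map_add polyGermHom p q

theorem polyGerm_mul (p q : MvPolynomial (Fin 2) ℝ) :
    polyGerm (p * q) = polyGerm p * polyGerm q := map_mul polyGermHom p q

theorem polyGerm_zero : polyGerm 0 = 0 := map_zero polyGermHom

theorem polyGerm_injective_of_flat {p q : MvPolynomial (Fin 2) ℝ}
    (h : IsFlat (polyGerm p - polyGerm q)) : p = q := by
  ext α
  have := isFlat_iff.1 h α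
  rwa [taylorCoeff_sub, taylorCoeff_polyGerm, taylorCoeff_polyGerm, sub_eq_zero] at this

/-- The germ of `c X^α`. -/
noncomputable abbrev termGerm (α : Expo) (c : ℝ) : SmoothGerm :=
  polyGerm (MvPolynomial.monomial α c)

theorem taylorCoeff_termGerm (α β : Expo) (c : ℝ) :
    taylorCoeff (termGerm α c) β = if α = β then c else 0 := by
  classical
  rw [taylorCoeff_polyGerm, MvPolynomial.coeff_monomial]

theorem termGerm_mul (α β : Expo) (c d : ℝ) :
    termGerm α c * termGerm β d = termGerm (α + β) (c * d) := by
  rw [← polyGerm_mul, MvPolynomial.monomial_mul]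

theorem taylorCoeff_termGerm_mul (γ : Expo) (c : ℝ) (u : SmoothGerm) (α : Expo) :
    taylorCoeff (termGerm γ c * u) α = if γ ≤ α then c * taylorCoeff u (α - γ) else 0 := by
  classical
  rw [← coeff_jet, map_mul, jet_polyGerm, MvPolynomial.coe_monomial,
    MvPowerSeries.coeff_monomial_mul]
  rfl

theorem exists_of_taylorCoeff_mul_ne_zero {u w : SmoothGerm} {α : Expo}
    (h : taylorCoeff (u * w) α ≠ 0) :
    ∃ β γ, α = β + γ ∧ taylorCoeff u β ≠ 0 ∧ taylorCoeff w γ ≠ 0 := by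
  rw [taylorCoeff_mul] at h
  obtain ⟨p, hp, hne⟩ := Finset.exists_ne_zero_of_sum_ne_zero h
  exact ⟨p.1, p.2, (Finset.HasAntidiagonal.mem_antidiagonal.1 hp).symm, left_ne_zero_of_mul hne,
    right_ne_zero_of_mul hne⟩

/-- Hadamard's lemma for germs, with control of the Taylor coefficients. -/
theorem exists_eq_coord_mul_add {u : SmoothGerm} (h0 : taylorCoeff u 0 = 0) :
    ∃ w : Fin 2 → SmoothGerm,
      u = polyGerm (MvPolynomial.X 0) * w 0 + polyGerm (MvPolynomial.X 1) * w 1 ∧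
      ∀ i α, taylorCoeff u (α + Finsupp.single i 1) = 0 → taylorCoeff (w i) α = 0 := by
  obtain ⟨f, hf, rfl⟩ := exists_germOf_eq u
  refine ⟨fun i => germOf (radialMean 0 (partialD i f))
    (contDiff_radialMean (contDiff_partialD hf i) 0), ?_, fun i α h => ?_⟩
  · have hf0 : f 0 = 0 := by
      rw [← coeff_jet, jet_eq_infJet, infJet_germOf, constantCoeff_taylorSeries] at h0
      exact h0
    refine Subtype.ext ?_
    change (f : Germ (𝓝 (0 : Plane)) ℝ) = ((fun v => MvPolynomial.eval v (MvPolynomial.X 0) *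
      radialMean 0 (partialD 0 f) v + MvPolynomial.eval v (MvPolynomial.X 1) *
      radialMean 0 (partialD 1 f) v : Plane → ℝ) : Germ (𝓝 (0 : Plane)) ℝ)
    congr 1
    ext v
    simpa using eq_sum_coord_mul_radialMean hf hf0 v
  -- The coefficient of `w i` at `α` is `(α i + 1) / (α.degree + 1)` times that of `u` at `α + e_i`.
  · rw [← coeff_jet, jet_eq_infJet, infJet_germOf] at h ⊢
    rw [coeff_taylorSeries_radialMean (contDiff_partialD hf i), ← pderiv_taylorSeries hf,
      MvPowerSeries.coeff_pderiv, h, zero_mul, zero_div]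

theorem isUnit_of_taylorCoeff_zero_ne_zero {u : SmoothGerm} (h : taylorCoeff u 0 ≠ 0) :
    IsUnit u := by
  obtain ⟨f, hf, rfl⟩ := exists_germOf_eq u
  rw [← coeff_jet, jet_eq_infJet, infJet_germOf, constantCoeff_taylorSeries] at h
  have hne : ∀ᶠ v in 𝓝 (0 : Plane), f v ≠ 0 :=
    hf.continuous.continuousAt.eventually_ne h
  refine IsUnit.of_mul_eq_one
    ⟨((fun v => (f v)⁻¹ : Plane → ℝ) : Germ (𝓝 (0 : Plane)) ℝ), _, ?_, rfl⟩ ?_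
  · filter_upwards [hne] with v hv
    exact hf.contDiffAt.inv hv
  · refine Subtype.ext (Germ.coe_eq.2 ?_)
    filter_upwards [hne] with v hv
    exact mul_inv_cancel₀ hv

/-! Powers of the maximal ideal and flat germs. -/

/-- The germs all of whose Taylor coefficients of degree less than `n` vanish. -/
noncomputable def vanishingIdeal (n : ℕ) : Ideal SmoothGerm where
  carrier := {u | ∀ α : Expo, α.degree < n → taylorCoeff u α = 0}
  zero_mem' α _ := taylorCoeff_zero α
  add_mem' {u w} hu hw α hα := by rw [taylorCoeff_add, hu α hα, hw α hα, add_zero]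
  smul_mem' c u hu α hα := by
    by_contra h
    obtain ⟨β, γ, rfl, -, hγ⟩ := exists_of_taylorCoeff_mul_ne_zero (u := c) h
    rw [map_add] at hα
    exact hγ (hu γ (by omega))

theorem mem_vanishingIdeal {n : ℕ} {u : SmoothGerm} :
    u ∈ vanishingIdeal n ↔ ∀ α : Expo, α.degree < n → taylorCoeff u α = 0 := Iff.rfl

theorem vanishingIdeal_mul_le (m n : ℕ) :
    vanishingIdeal m * vanishingIdeal n ≤ vanishingIdeal (m + n) := by
  refine Ideal.mul_le.2 fun u hu w hw α hα => ?_
  by_contra h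
  obtain ⟨β, γ, rfl, hβ, hγ⟩ := exists_of_taylorCoeff_mul_ne_zero h
  have h1 : m ≤ β.degree := not_lt.1 fun h => hβ (hu β h)
  have h2 : n ≤ γ.degree := not_lt.1 fun h => hγ (hw γ h)
  rw [map_add] at hα
  omega

theorem polyGerm_X_mem_maxIdeal (i : Fin 2) : polyGerm (MvPolynomial.X i) ∈ maxIdeal := by
  refine Ideal.subset_span ?_
  fin_cases i <;> simp

/-- The substantial inclusion is Hadamard's lemma: the quotients of a germ vanishing to order `n +
1` vanish to order `n`. -/
theorem maxIdeal_pow_eq (n : ℕ) : maxIdeal ^ n = vanishingIdeal n := by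
  refine le_antisymm ?_ ?_
  · have h1 : maxIdeal ≤ vanishingIdeal 1 := by
      have hX : ∀ i, polyGerm (MvPolynomial.X i) ∈ vanishingIdeal 1 := by
        intro i α hα
        obtain rfl := (Finsupp.degree_eq_zero_iff α).1 (by omega)
        rw [taylorCoeff_polyGerm, MvPolynomial.coeff_zero_X]
      refine Ideal.span_le.2 ?_
      rintro _ (rfl | rfl)
      exacts [hX 0, hX 1]
    induction n with
    | zero => intro u _ α hα; omega
    | succ n ih =>
      rw [pow_succ]
      exact (Ideal.mul_mono ih h1).trans (vanishingIdeal_mul_le n 1)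
  · induction n with
    | zero => simp
    | succ n ih =>
      intro u hu
      obtain ⟨w, rfl, hw⟩ := exists_eq_coord_mul_add (hu 0 (by simp))
      have hmem : ∀ i, w i ∈ maxIdeal ^ n := fun i => ih fun α hα =>
        hw i α (hu _ (by rw [map_add, Finsupp.degree_single]; omega))
      rw [pow_succ']
      exact add_mem (Ideal.mul_mem_mul (polyGerm_X_mem_maxIdeal 0) (hmem 0))
        (Ideal.mul_mem_mul (polyGerm_X_mem_maxIdeal 1) (hmem 1))

/-- The ideal of flat germs. -/
noncomputable def flatIdeal : Ideal SmoothGerm := RingHom.ker jet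

theorem mem_flatIdeal {u : SmoothGerm} : u ∈ flatIdeal ↔ IsFlat u := Iff.rfl

/-- The Hadamard quotients of a flat germ are again flat, so the argument iterates. -/
theorem flatIdeal_le_maxIdeal_pow_mul (n : ℕ) : flatIdeal ≤ maxIdeal ^ n * flatIdeal := by
  have h1 : flatIdeal ≤ maxIdeal * flatIdeal := by
    intro u hu
    have hu' := isFlat_iff.1 (mem_flatIdeal.1 hu)
    obtain ⟨w, rfl, hw⟩ := exists_eq_coord_mul_add (hu' 0)
    have hmem : ∀ i, w i ∈ flatIdeal := fun i =>
      mem_flatIdeal.2 (isFlat_iff.2 fun α => hw i α (hu' _))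
    exact add_mem (Ideal.mul_mem_mul (polyGerm_X_mem_maxIdeal 0) (hmem 0))
      (Ideal.mul_mem_mul (polyGerm_X_mem_maxIdeal 1) (hmem 1))
  induction n with
  | zero => simp
  | succ n ih =>
    calc flatIdeal ≤ maxIdeal ^ n * flatIdeal := ih
      _ ≤ maxIdeal ^ n * (maxIdeal * flatIdeal) := Ideal.mul_mono le_rfl h1
      _ = maxIdeal ^ (n + 1) * flatIdeal := by rw [pow_succ, mul_assoc]

/-- Needed for Nakayama's lemma: `u * y + 1` takes the value 1 at the origin, so it is invertible.
-/
theorem maxIdeal_le_jacobson_bot : maxIdeal ≤ Ideal.jacobson ⊥ := by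
  intro u hu
  rw [Ideal.mem_jacobson_bot]
  intro y
  refine isUnit_of_taylorCoeff_zero_ne_zero ?_
  have h1 : u * y ∈ vanishingIdeal 1 := by
    rw [← maxIdeal_pow_eq, pow_one]
    exact Ideal.mul_mem_right _ _ hu
  rw [taylorCoeff_add, h1 0 (by simp), zero_add, ← coeff_jet, map_one]
  simp

theorem maxIdeal_pow_fg (n : ℕ) : (maxIdeal ^ n).FG :=
  Ideal.FG.pow (Submodule.fg_span (Set.toFinite _))

theorem exists_sum_of_mem_mul_span {A : Ideal SmoothGerm} {G : Finset SmoothGerm}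
    {u : SmoothGerm} (hu : u ∈ A * Ideal.span (G : Set SmoothGerm)) :
    ∃ q : SmoothGerm → SmoothGerm, (∀ g, q g ∈ A) ∧ u = ∑ g ∈ G, q g * g := by
  refine Submodule.mul_induction_on hu (fun a ha w hw => ?_) ?_
  · obtain ⟨c, -, rfl⟩ := Submodule.mem_span_finset.1 hw
    refine ⟨fun g => a * c g, fun g => A.mul_mem_right _ ha, ?_⟩
    simp only [Finset.mul_sum, smul_eq_mul, mul_assoc]
  · rintro _ _ ⟨q, hq, rfl⟩ ⟨q', hq', rfl⟩
    refine ⟨fun g => q g + q' g, fun g => add_mem (hq g) (hq' g), ?_⟩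
    simp only [add_mul, Finset.sum_add_distrib]

/-! Local orders and leading exponents. -/

section LocalOrder

variable {r : Expo → Expo → Prop}

theorem IsLocalOrder.trans' (hr : IsLocalOrder r) {α β γ : Expo} (h : r α β) (h' : r β γ) :
    r α γ := hr.strictTotal.trans _ _ _ h h'

theorem IsLocalOrder.asymm' (hr : IsLocalOrder r) {α β : Expo} (h : r α β) : ¬ r β α :=
  fun h' => hr.strictTotal.irrefl _ (hr.trans' h h')

theorem IsLocalOrder.lt_or_lt (hr : IsLocalOrder r) {α β : Expo} (h : α ≠ β) :
    r α β ∨ r β α := by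
  have := hr.strictTotal
  rcases trichotomous_of r α β with h' | h' | h'
  exacts [Or.inl h', absurd h' h, Or.inr h']

/-- Each variable lies below 1, so every further factor makes a monomial smaller. -/
theorem IsLocalOrder.of_le (hr : IsLocalOrder r) {α β : Expo} (h : α ≤ β) :
    β = α ∨ r β α := by
  have key : ∀ n : ℕ, ∀ γ : Expo, γ.degree = n → α + γ = α ∨ r (α + γ) α := by
    intro n
    induction n with
    | zero =>
      intro γ hγ
      rw [(Finsupp.degree_eq_zero_iff γ).1 hγ, add_zero]
      exact Or.inl rfl
    | succ n ih =>
      intro γ hγ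
      obtain ⟨δ, i, rfl⟩ := exists_eq_add_single_of_ne_zero (α := γ) (by rintro rfl; simp at hγ)
      have h1 := hr.add_right _ _ (α + δ) (hr.var_lt_one i)
      rw [zero_add, add_comm, add_assoc] at h1
      have h2 := ih δ (by rw [map_add, Finsupp.degree_single] at hγ; omega)
      right
      rcases h2 with h2 | h2
      · rwa [h2] at h1
      · exact hr.trans' h1 h2
  obtain ⟨γ, rfl⟩ := exists_add_of_le h
  exact key _ γ rfl

/-- Dickson's lemma: an infinite ascending sequence would contain a later monomial divisible by an
earlier one, which cannot be larger. -/
theorem IsLocalOrder.wellFounded (hr : IsLocalOrder r) :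
    WellFounded fun α β : Expo => r β α := by
  have := hr.strictTotal
  have : IsStrictOrder Expo fun α β => r β α :=
    { irrefl := fun a => hr.strictTotal.irrefl a
      trans := fun a b c h h' => hr.trans' h' h }
  refine RelEmbedding.wellFounded_iff_isEmpty.2 ⟨fun f => ?_⟩
  obtain ⟨m, n, hmn, hle⟩ := wellQuasiOrdered_le (α := Expo) f
  have h1 : r (f m) (f n) := f.map_rel_iff.2 hmn
  rcases hr.of_le hle with h | h
  · rw [h] at h1
    exact hr.strictTotal.irrefl _ h1
  · exact hr.asymm' h1 h

theorem IsLocalOrder.exists_max (hr : IsLocalOrder r) {s : Set Expo} (hs : s.Nonempty) :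
    ∃ β ∈ s, ∀ α ∈ s, α = β ∨ r α β := by
  obtain ⟨β, hβ, h⟩ := hr.wellFounded.has_min s hs
  refine ⟨β, hβ, fun α hα => ?_⟩
  by_contra! hne
  exact (hr.lt_or_lt hne.1).elim hne.2 (h α hα)

theorem IsLocalOrder.exists_isLeadExpo (hr : IsLocalOrder r) {f : SmoothGerm} (hf : ¬ IsFlat f) :
    ∃ α, IsLeadExpo r f α := by
  rw [isFlat_iff, not_forall] at hf
  obtain ⟨α, hα, h⟩ := hr.exists_max (s := {α | taylorCoeff f α ≠ 0}) hf
  exact ⟨α, hα, fun β hβ hne => (h β hβ).resolve_left hne⟩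

theorem IsLeadExpo.unique (hr : IsLocalOrder r) {f : SmoothGerm} {α β : Expo}
    (hα : IsLeadExpo r f α) (hβ : IsLeadExpo r f β) : α = β := by
  by_contra h
  exact hr.asymm' (hα.2 β hβ.1 (Ne.symm h)) (hβ.2 α hα.1 h)

theorem IsLeadExpo.leadTerm_eq (hr : IsLocalOrder r) {f : SmoothGerm} {α : Expo}
    (hα : IsLeadExpo r f α) : leadTerm r f = termGerm α (taylorCoeff f α) := by
  have h : ∃ α, IsLeadExpo r f α := ⟨α, hα⟩
  rw [leadTerm, dif_pos h, IsLeadExpo.unique hr h.choose_spec hα]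

theorem IsLeadExpo.leadCoeff_eq (hr : IsLocalOrder r) {f : SmoothGerm} {α : Expo}
    (hα : IsLeadExpo r f α) : leadCoeff r f = taylorCoeff f α := by
  have h : ∃ α, IsLeadExpo r f α := ⟨α, hα⟩
  rw [leadCoeff, dif_pos h, IsLeadExpo.unique hr h.choose_spec hα]

theorem leadTerm_eq_zero {f : SmoothGerm} (h : ¬ ∃ α, IsLeadExpo r f α) : leadTerm r f = 0 :=
  dif_neg h

theorem leadCoeff_eq_zero {f : SmoothGerm} (h : ¬ ∃ α, IsLeadExpo r f α) : leadCoeff r f = 0 :=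
  dif_neg h

theorem IsLeadExpo.termGerm_mul (hr : IsLocalOrder r) {f : SmoothGerm} {α : Expo}
    (hα : IsLeadExpo r f α) (γ : Expo) {c : ℝ} (hc : c ≠ 0) :
    IsLeadExpo r (termGerm γ c * f) (α + γ) := by
  refine ⟨?_, fun β hβ hne => ?_⟩
  · rw [taylorCoeff_termGerm_mul, if_pos le_add_self, add_tsub_cancel_right]
    exact mul_ne_zero hc hα.1
  · rw [taylorCoeff_termGerm_mul] at hβ
    split_ifs at hβ with h
    · obtain ⟨δ, rfl⟩ := exists_add_of_le h
      rw [add_tsub_cancel_left] at hβ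
      rw [add_comm γ δ] at hne ⊢
      exact hr.add_right _ _ _ (hα.2 δ (right_ne_zero_of_mul hβ) fun h => hne (by rw [h]))
    · exact absurd rfl hβ

theorem termGerm_dvd_iff {α β : Expo} {c d : ℝ} (hc : c ≠ 0) (hd : d ≠ 0) :
    termGerm α c ∣ termGerm β d ↔ α ≤ β := by
  constructor
  · rintro ⟨u, hu⟩
    have h := congrArg (fun u => taylorCoeff u β) hu
    simp only [taylorCoeff_termGerm_mul, taylorCoeff_termGerm, if_true] at h
    by_contra hle
    rw [if_neg hle] at h
    exact hd h
  · intro h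
    refine ⟨termGerm (β - α) (c⁻¹ * d), ?_⟩
    rw [_root_.termGerm_mul, add_tsub_cancel_of_le h, mul_inv_cancel_left₀ hc]

theorem leadTerm_dvd_termGerm_iff (hr : IsLocalOrder r) {g : SmoothGerm} {α : Expo} {d : ℝ}
    (hd : d ≠ 0) : leadTerm r g ∣ termGerm α d ↔ ∃ γ, IsLeadExpo r g γ ∧ γ ≤ α := by
  by_cases h : ∃ γ, IsLeadExpo r g γ
  · obtain ⟨γ, hγ⟩ := h
    rw [hγ.leadTerm_eq hr, termGerm_dvd_iff hγ.1 hd]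
    refine ⟨fun h => ⟨γ, hγ, h⟩, ?_⟩
    rintro ⟨δ, hδ, h⟩
    rwa [hγ.unique hr hδ]
  · rw [leadTerm_eq_zero h, zero_dvd_iff]
    refine ⟨fun h0 => absurd ?_ hd, fun ⟨γ, hγ, _⟩ => absurd ⟨γ, hγ⟩ h⟩
    have := taylorCoeff_termGerm α α d
    rwa [h0, taylorCoeff_zero, if_pos rfl, eq_comm] at this

/-! Leading exponents of an ideal. -/

/-- The exponents of the leading monomials of the elements of `I`. -/
def leadExpos (r : Expo → Expo → Prop) (I : Ideal SmoothGerm) : Set Expo :=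
  {α | ∃ f ∈ I, IsLeadExpo r f α}

theorem leadExpos_of_le (hr : IsLocalOrder r) {I : Ideal SmoothGerm} {α β : Expo}
    (hα : α ∈ leadExpos r I) (h : α ≤ β) : β ∈ leadExpos r I := by
  obtain ⟨f, hf, hlead⟩ := hα
  obtain ⟨γ, rfl⟩ := exists_add_of_le h
  exact ⟨_, I.mul_mem_left _ hf, hlead.termGerm_mul hr γ one_ne_zero⟩

theorem isLeadExpo_termGerm (α : Expo) {c : ℝ} (hc : c ≠ 0) :
    IsLeadExpo r (termGerm α c) α := by
  refine ⟨by rwa [taylorCoeff_termGerm, if_pos rfl], fun β hβ hne => ?_⟩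
  rw [taylorCoeff_termGerm, if_neg (Ne.symm hne)] at hβ
  exact absurd rfl hβ

theorem termGerm_mem_maxIdeal_pow {n : ℕ} {α : Expo} (h : n ≤ α.degree) (c : ℝ) :
    termGerm α c ∈ maxIdeal ^ n := by
  rw [maxIdeal_pow_eq]
  intro β hβ
  rw [taylorCoeff_termGerm, if_neg]
  rintro rfl
  omega

theorem mem_leadExpos_of_le_degree {I : Ideal SmoothGerm} {n : ℕ} (hI : maxIdeal ^ n ≤ I)
    {α : Expo} (h : n ≤ α.degree) : α ∈ leadExpos r I :=
  ⟨_, hI (termGerm_mem_maxIdeal_pow h 1), isLeadExpo_termGerm α one_ne_zero⟩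

/-- Otherwise the leading exponent of `s` would itself belong to LT(I). All uniqueness statements
reduce to this. -/
theorem isFlat_of_forall_notMem_leadExpos (hr : IsLocalOrder r) {I : Ideal SmoothGerm}
    {s : SmoothGerm} (hs : s ∈ I) (h : ∀ α, taylorCoeff s α ≠ 0 → α ∉ leadExpos r I) :
    IsFlat s := by
  by_contra hf
  obtain ⟨α, hα⟩ := hr.exists_isLeadExpo hf
  exact h α hα.1 ⟨s, hs, hα⟩

/-- Every leading monomial of `I` is a multiple of that of an element of `G`. -/
def CoversLeadExpos (r : Expo → Expo → Prop) (I : Ideal SmoothGerm) (G : Set SmoothGerm) : Prop :=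
  ∀ α ∈ leadExpos r I, ∃ g ∈ G, ∃ γ, IsLeadExpo r g γ ∧ γ ≤ α

theorem coversLeadExpos_self (I : Ideal SmoothGerm) : CoversLeadExpos r I I :=
  fun α ⟨f, hf, h⟩ => ⟨f, hf, α, h, le_rfl⟩

theorem IsStandardBasis.subset {I : Ideal SmoothGerm} {G : Finset SmoothGerm}
    (hG : IsStandardBasis r I G) {g : SmoothGerm} (hg : g ∈ G) : g ∈ I := by
  rw [← hG.span_eq]
  exact Ideal.subset_span hg

theorem IsStandardBasis.coversLeadExpos (hr : IsLocalOrder r) {I : Ideal SmoothGerm}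
    {G : Finset SmoothGerm} (hG : IsStandardBasis r I G) : CoversLeadExpos r I G := by
  rintro α ⟨f, hf, hα⟩
  have hmem : leadTerm r f ∈ leadIdeal r I := Ideal.subset_span ⟨f, hf, rfl⟩
  rw [hG.leadIdeal_eq] at hmem
  -- The ideal is taken over all smooth germs, so its elements are not polynomials; the induction is
  -- on a condition on every exponent of the Taylor series.
  have key : ∀ u ∈ Ideal.span {t | ∃ g ∈ G, t = leadTerm r g}, ∀ β, taylorCoeff u β ≠ 0 →
      ∃ g ∈ (G : Set SmoothGerm), ∃ γ, IsLeadExpo r g γ ∧ γ ≤ β := by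
    intro u hu
    refine Submodule.span_induction ?_ ?_ ?_ ?_ hu
    · rintro _ ⟨g, hg, rfl⟩ β hβ
      by_cases h : ∃ γ, IsLeadExpo r g γ
      · obtain ⟨γ, hγ⟩ := h
        rw [hγ.leadTerm_eq hr, taylorCoeff_termGerm] at hβ
        have : γ = β := by
          by_contra hne
          exact hβ (if_neg hne)
        exact ⟨g, hg, γ, hγ, this.le⟩
      · rw [leadTerm_eq_zero h, taylorCoeff_zero] at hβ
        exact absurd rfl hβ
    · intro β hβ
      exact absurd (taylorCoeff_zero β) hβ
    · intro u w _ _ hu hw β hβ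
      rw [taylorCoeff_add] at hβ
      by_cases h : taylorCoeff u β = 0
      · exact hw β fun h' => hβ (by rw [h, h', add_zero])
      · exact hu β h
    · intro c u _ hu β hβ
      obtain ⟨δ, ε, rfl, -, hε⟩ := exists_of_taylorCoeff_mul_ne_zero (u := c) hβ
      obtain ⟨g, hg, γ, hγ, hle⟩ := hu ε hε
      exact ⟨g, hg, γ, hγ, hle.trans le_add_self⟩
  refine key _ hmem α ?_
  rw [hα.leadTerm_eq hr, taylorCoeff_termGerm, if_pos rfl]
  exact hα.1

theorem CoversLeadExpos.leadIdeal_eq (hr : IsLocalOrder r) {I : Ideal SmoothGerm}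
    {G : Set SmoothGerm} (hG : CoversLeadExpos r I G) (hGI : G ⊆ I) :
    leadIdeal r I = Ideal.span {t | ∃ g ∈ G, t = leadTerm r g} := by
  refine le_antisymm (Ideal.span_le.2 ?_) (Ideal.span_mono ?_)
  · rintro _ ⟨f, hf, rfl⟩
    by_cases h : ∃ α, IsLeadExpo r f α
    · obtain ⟨α, hα⟩ := h
      obtain ⟨g, hg, γ, hγ, hle⟩ := hG α ⟨f, hf, hα⟩
      rw [hα.leadTerm_eq hr]
      exact Ideal.mem_of_dvd _ ((leadTerm_dvd_termGerm_iff hr hα.1).2 ⟨γ, hγ, hle⟩)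
        (Ideal.subset_span ⟨g, hg, rfl⟩)
    · rw [leadTerm_eq_zero h]
      exact zero_mem _
  · rintro _ ⟨g, hg, rfl⟩
    exact ⟨g, hGI hg, rfl⟩

theorem forall_notMem_leadExpos_iff (hr : IsLocalOrder r) {I : Ideal SmoothGerm}
    {G : Set SmoothGerm} (hG : CoversLeadExpos r I G) (hGI : G ⊆ I) (s : SmoothGerm) :
    (∀ t ∈ Terms s, ∀ g ∈ G, ¬ leadTerm r g ∣ t) ↔
      ∀ α, taylorCoeff s α ≠ 0 → α ∉ leadExpos r I := by
  constructor
  · intro h α hα hmem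
    obtain ⟨g, hg, γ, hγ, hle⟩ := hG α hmem
    exact h _ ⟨α, hα, rfl⟩ g hg ((leadTerm_dvd_termGerm_iff hr hα).2 ⟨γ, hγ, hle⟩)
  · rintro h _ ⟨α, hα, rfl⟩ g hg hdvd
    obtain ⟨γ, hγ, hle⟩ := (leadTerm_dvd_termGerm_iff hr hα).1 hdvd
    exact h α hα (leadExpos_of_le hr ⟨g, hGI hg, hγ⟩ hle)

end LocalOrder

/-! ### Division with remainder modulo a power of the maximal ideal -/

section NormalForm

variable {r : Expo → Expo → Prop}

/-- The multiples `c X^γ g` of elements of `G` whose leading monomial is at most `X^β`. -/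
def boundedMultiples (r : Expo → Expo → Prop) (G : Set SmoothGerm) (β : Expo) :
    Set SmoothGerm :=
  {u | ∃ γ c, ∃ g ∈ G, u = termGerm γ c * g ∧
    ∀ α, taylorCoeff u α ≠ 0 → α = β ∨ r α β}

theorem boundedMultiples_mono (hr : IsLocalOrder r) (G : Set SmoothGerm) {β β' : Expo}
    (h : β' = β ∨ r β' β) : boundedMultiples r G β' ⊆ boundedMultiples r G β := by
  rintro u ⟨γ, c, g, hg, rfl, hu⟩
  refine ⟨γ, c, g, hg, rfl, fun α hα => ?_⟩
  rcases h with rfl | h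
  · exact hu α hα
  · rcases hu α hα with rfl | h'
    exacts [Or.inr h, Or.inr (hr.trans' h' h)]

theorem mem_maxIdeal_pow {n : ℕ} {u : SmoothGerm} :
    u ∈ maxIdeal ^ n ↔ ∀ α : Expo, α.degree < n → taylorCoeff u α = 0 := by
  rw [maxIdeal_pow_eq, mem_vanishingIdeal]

/-- A local order has infinite descending chains, but only finitely many exponents have degree below
`n`, so induction on `β` among them is available. Terms of higher degree are ignored. -/
theorem exists_normalForm_of_degree_lt (hr : IsLocalOrder r) {I : Ideal SmoothGerm}
    {G : Set SmoothGerm} (hG : CoversLeadExpos r I G) {n : ℕ} {β : Expo} (hβ : β.degree < n) :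
    ∀ f : SmoothGerm, (∀ α, taylorCoeff f α ≠ 0 → α.degree < n → α = β ∨ r α β) →
    ∃ p : MvPolynomial (Fin 2) ℝ,
      (∀ α, p.coeff α ≠ 0 → α ∉ leadExpos r I ∧ (α = β ∨ r α β)) ∧
      ∃ h ∈ AddSubmonoid.closure (boundedMultiples r G β), f - polyGerm p - h ∈ maxIdeal ^ n := by
  classical
  have hfin : {α : Expo | α.degree < n}.Finite :=
    (Finsupp.finite_of_degree_le n).subset fun α (hα : α.degree < n) => hα.le
  have := hr.strictTotal
  have hwf : {α : Expo | α.degree < n}.WellFoundedOn r := hfin.wellFoundedOn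
  refine hwf.induction (P := fun β => ∀ f : SmoothGerm,
    (∀ α, taylorCoeff f α ≠ 0 → α.degree < n → α = β ∨ r α β) →
    ∃ p : MvPolynomial (Fin 2) ℝ,
      (∀ α, p.coeff α ≠ 0 → α ∉ leadExpos r I ∧ (α = β ∨ r α β)) ∧
      ∃ h ∈ AddSubmonoid.closure (boundedMultiples r G β),
        f - polyGerm p - h ∈ maxIdeal ^ n) hβ ?_
  intro β hβ ih f hf
  -- One division step removes the exponent `β`: if it is in LT(I), a multiple of an element of `G`
  -- cancels it; otherwise its term moves to the remainder.
  obtain ⟨p₀, h₀, hp₀, hh₀, hf₀⟩ : ∃ p₀ : MvPolynomial (Fin 2) ℝ, ∃ h₀ : SmoothGerm,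
      (∀ α, p₀.coeff α ≠ 0 → α ∉ leadExpos r I ∧ (α = β ∨ r α β)) ∧
      h₀ ∈ AddSubmonoid.closure (boundedMultiples r G β) ∧
      ∀ α, taylorCoeff (f - polyGerm p₀ - h₀) α ≠ 0 → α.degree < n → r α β := by
    by_cases hL : β ∈ leadExpos r I
    · obtain ⟨g, hg, γ, hγ, hle⟩ := hG β hL
      obtain ⟨δ, rfl⟩ := exists_add_of_le hle
      have hbd : ∀ c : ℝ, ∀ α, taylorCoeff (termGerm δ c * g) α ≠ 0 →
          α = γ + δ ∨ r α (γ + δ) := by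
        intro c α hα
        have hc : c ≠ 0 := by
          rintro rfl
          simp [taylorCoeff_termGerm_mul] at hα
        have h := hγ.termGerm_mul hr δ hc
        by_cases hne : α = γ + δ
        · exact Or.inl hne
        · exact Or.inr (h.2 α hα hne)
      set c := taylorCoeff f (γ + δ) / taylorCoeff g γ with hc
      refine ⟨0, termGerm δ c * g, by simp,
        AddSubmonoid.subset_closure ⟨δ, c, g, hg, rfl, hbd c⟩, fun α hα hdeg => ?_⟩
      rw [polyGerm_zero, sub_zero, taylorCoeff_sub] at hα
      have hne : α ≠ γ + δ := by
        rintro rfl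
        rw [taylorCoeff_termGerm_mul, if_pos le_add_self, add_tsub_cancel_right, hc,
          div_mul_cancel₀ _ hγ.1, sub_self] at hα
        exact hα rfl
      by_cases h : taylorCoeff f α = 0
      · rw [h, zero_sub, neg_ne_zero] at hα
        exact (hbd c α hα).resolve_left hne
      · exact (hf α h hdeg).resolve_left hne
    · refine ⟨MvPolynomial.monomial β (taylorCoeff f β), 0, fun α hα => ?_, zero_mem _,
        fun α hα hdeg => ?_⟩
      · rw [MvPolynomial.coeff_monomial] at hα
        have : β = α := by
          by_contra hne
          exact hα (if_neg hne)
        subst this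
        exact ⟨hL, Or.inl rfl⟩
      · rw [sub_zero, taylorCoeff_sub, taylorCoeff_termGerm] at hα
        have hne : β ≠ α := by
          rintro rfl
          simp at hα
        rw [if_neg hne, sub_zero] at hα
        exact (hf α hα hdeg).resolve_left hne.symm
  set f' := f - polyGerm p₀ - h₀ with hf'
  -- Continue at the largest exponent left in degree below `n`; if there is none, what is left lies
  -- in `maxIdeal ^ n`.
  by_cases hz : {α : Expo | taylorCoeff f' α ≠ 0 ∧ α.degree < n}.Nonempty
  · obtain ⟨β', hβ', hmax⟩ := hr.exists_max hz
    have hlt : r β' β := hf₀ β' hβ'.1 hβ'.2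
    obtain ⟨p₁, hp₁, h₁, hh₁, hf₁⟩ := ih β' hβ'.2 hlt f' fun α hα hdeg => hmax α ⟨hα, hdeg⟩
    refine ⟨p₀ + p₁, fun α hα => ?_, h₀ + h₁, add_mem hh₀
      (AddSubmonoid.closure_mono (boundedMultiples_mono hr G (Or.inr hlt)) hh₁), ?_⟩
    · by_cases h : p₀.coeff α = 0
      · rw [MvPolynomial.coeff_add, h, zero_add] at hα
        refine ⟨(hp₁ α hα).1, Or.inr ?_⟩
        rcases (hp₁ α hα).2 with rfl | h'
        exacts [hlt, hr.trans' h' hlt]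
      · exact hp₀ α h
    · have : f - polyGerm (p₀ + p₁) - (h₀ + h₁) = f' - polyGerm p₁ - h₁ := by
        rw [hf', polyGerm_add]
        ring
      rwa [this]
  · refine ⟨p₀, hp₀, h₀, hh₀, mem_maxIdeal_pow.2 fun α hα => ?_⟩
    by_contra h
    exact hz ⟨α, h, hα⟩

/-- Division by `G` up to a given order, with a remainder having no term in `LT(I)`. -/
theorem exists_normalForm (hr : IsLocalOrder r) {I : Ideal SmoothGerm}
    {G : Set SmoothGerm} (hG : CoversLeadExpos r I G) (n : ℕ) {β : Expo} (f : SmoothGerm)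
    (hf : ∀ α, taylorCoeff f α ≠ 0 → α.degree < n → α = β ∨ r α β) :
    ∃ p : MvPolynomial (Fin 2) ℝ,
      (∀ α, p.coeff α ≠ 0 → α ∉ leadExpos r I ∧ (α = β ∨ r α β)) ∧
      ∃ h ∈ AddSubmonoid.closure (boundedMultiples r G β), f - polyGerm p - h ∈ maxIdeal ^ n := by
  by_cases hz : {α : Expo | taylorCoeff f α ≠ 0 ∧ α.degree < n}.Nonempty
  · obtain ⟨β', hβ', hmax⟩ := hr.exists_max hz
    have hle := hf β' hβ'.1 hβ'.2
    obtain ⟨p, hp, h, hh, hfp⟩ := exists_normalForm_of_degree_lt hr hG hβ'.2 f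
      fun α hα hdeg => hmax α ⟨hα, hdeg⟩
    refine ⟨p, fun α hα => ⟨(hp α hα).1, ?_⟩, h,
      AddSubmonoid.closure_mono (boundedMultiples_mono hr G hle) hh, hfp⟩
    rcases (hp α hα).2 with rfl | h'
    · exact hle
    · rcases hle with rfl | hle
      exacts [Or.inr h', Or.inr (hr.trans' h' hle)]
  · refine ⟨0, by simp, 0, zero_mem _, mem_maxIdeal_pow.2 fun α hα => ?_⟩
    rw [polyGerm_zero, sub_zero, sub_zero]
    by_contra h
    exact hz ⟨α, h, hα⟩

theorem closure_boundedMultiples_le_span (G : Set SmoothGerm) (β : Expo) {h : SmoothGerm}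
    (hh : h ∈ AddSubmonoid.closure (boundedMultiples r G β)) : h ∈ Ideal.span G := by
  refine AddSubmonoid.closure_induction ?_ (zero_mem _) (fun _ _ _ _ => add_mem) hh
  rintro _ ⟨γ, c, g, hg, rfl, -⟩
  exact Ideal.mul_mem_left _ _ (Ideal.subset_span hg)

theorem exists_sum_of_mem_closure_boundedMultiples {G : Finset SmoothGerm} {β : Expo}
    {h : SmoothGerm} (hh : h ∈ AddSubmonoid.closure (boundedMultiples r G β)) :
    ∃ q : SmoothGerm → SmoothGerm, h = ∑ g ∈ G, q g * g ∧
      ∀ g ∈ G, ∀ α, taylorCoeff (q g * g) α ≠ 0 → α = β ∨ r α β := by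
  classical
  refine AddSubmonoid.closure_induction ?_ ?_ ?_ hh
  · rintro _ ⟨γ, c, g, hg, rfl, hb⟩
    refine ⟨fun g' => if g' = g then termGerm γ c else 0, ?_, fun g' _ α hα => ?_⟩
    · rw [Finset.sum_eq_single g]
      · simp
      · intro g' _ hne
        simp [hne]
      · intro hg'
        exact absurd hg hg'
    · by_cases hne : g' = g
      · subst hne
        exact hb α (by simpa using hα)
      · simp [hne, taylorCoeff_zero] at hα
  · exact ⟨0, by simp, fun g _ α hα => by simp [taylorCoeff_zero] at hα⟩
  · rintro _ _ _ _ ⟨q, rfl, hq⟩ ⟨q', rfl, hq'⟩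
    refine ⟨fun g => q g + q' g, by simp only [add_mul, Finset.sum_add_distrib],
      fun g hg α hα => ?_⟩
    rw [add_mul, taylorCoeff_add] at hα
    by_cases h : taylorCoeff (q g * g) α = 0
    · exact hq' g hg α fun h' => hα (by rw [h, h', add_zero])
    · exact hq g hg α h

theorem CoversLeadExpos.mem_sup_of_mem (hr : IsLocalOrder r) {I : Ideal SmoothGerm}
    {G : Set SmoothGerm} (hG : CoversLeadExpos r I G) (hGI : G ⊆ I) {n : ℕ}
    (hI : maxIdeal ^ n ≤ I) {f : SmoothGerm} (hf : f ∈ I) :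
    f ∈ Ideal.span G ⊔ maxIdeal ^ n := by
  -- The monomial 1 is the largest of all, so taking `β = 0` imposes no bound.
  have hmax : ∀ α, taylorCoeff f α ≠ 0 → α.degree < n → α = 0 ∨ r α 0 :=
    fun α _ _ => hr.of_le (zero_le (a := α))
  obtain ⟨p, hp, h, hh, hfp⟩ := exists_normalForm hr hG n f hmax
  have hh' := closure_boundedMultiples_le_span G 0 hh
  have hpI : polyGerm p ∈ I := by
    have : polyGerm p = f - (f - polyGerm p - h) - h := by ring
    rw [this]
    exact sub_mem (sub_mem hf (hI hfp)) (Ideal.span_le.2 hGI hh')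
  -- The remainder lies in `I` and has no exponent in LT(I), so it is flat.
  have hp0 : p = 0 := by
    refine polyGerm_injective_of_flat ?_
    rw [polyGerm_zero, sub_zero]
    refine isFlat_of_forall_notMem_leadExpos hr hpI fun α hα => ?_
    rw [taylorCoeff_polyGerm] at hα
    exact (hp α hα).1
  rw [hp0, polyGerm_zero, sub_zero] at hfp
  have : f = h + (f - h) := by ring
  rw [this]
  exact Submodule.add_mem_sup hh' hfp

/-- A subset of `I` whose leading monomials generate `LT(I)` generates `I`. -/
theorem CoversLeadExpos.span_eq (hr : IsLocalOrder r) {I : Ideal SmoothGerm}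
    (hI : FiniteCodimension I) {G : Set SmoothGerm} (hG : CoversLeadExpos r I G) (hGI : G ⊆ I) :
    Ideal.span G = I := by
  obtain ⟨k, hk⟩ := hI
  refine le_antisymm (Ideal.span_le.2 hGI) ?_
  -- Precision `k + 1` rather than `k` leaves the factor `maxIdeal` that Nakayama's lemma requires
  -- for `maxIdeal ^ k`.
  have h1 : I ≤ Ideal.span G ⊔ maxIdeal ^ (k + 1) := fun f hf =>
    hG.mem_sup_of_mem hr hGI ((Ideal.pow_le_pow_right k.le_succ).trans hk) hf
  have h2 : maxIdeal ^ k ≤ Ideal.span G := by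
    refine Submodule.le_of_le_smul_of_le_jacobson_bot (maxIdeal_pow_fg k)
      maxIdeal_le_jacobson_bot ?_
    rw [smul_eq_mul, ← pow_succ']
    exact hk.trans h1
  exact h1.trans (sup_le le_rfl ((Ideal.pow_le_pow_right k.le_succ).trans h2))

/-- For `X^β ∈ LT(I)`, a polynomial in `I` of the form `X^β` plus smaller terms not in `LT(I)`. -/
theorem exists_reduced_polynomial (hr : IsLocalOrder r) {I : Ideal SmoothGerm}
    (hI : FiniteCodimension I) {β : Expo} (hβ : β ∈ leadExpos r I) :
    ∃ p : MvPolynomial (Fin 2) ℝ, polyGerm p ∈ I ∧ p.coeff β = 1 ∧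
      ∀ α, p.coeff α ≠ 0 → α ≠ β → α ∉ leadExpos r I ∧ r α β := by
  classical
  obtain ⟨k, hk⟩ := hI
  have hmax : ∀ α, taylorCoeff (termGerm β 1) α ≠ 0 → α.degree < k → α = β ∨ r α β := by
    intro α hα _
    by_contra h
    rw [taylorCoeff_termGerm, if_neg fun h' => h (Or.inl h'.symm)] at hα
    exact hα rfl
  -- No basis is available yet, so `X^β` is divided by all of `I`; the error in `maxIdeal ^ k` lies
  -- in `I` as well.
  obtain ⟨p, hp, h, hh, hfp⟩ := exists_normalForm hr (coversLeadExpos_self I) k _ hmax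
  have hpβ : p.coeff β = 0 := by
    by_contra hne
    exact (hp β hne).1 hβ
  refine ⟨MvPolynomial.monomial β 1 - p, ?_, ?_, fun α hα hne => ?_⟩
  · have h1 : polyGerm (MvPolynomial.monomial β 1 - p) = termGerm β 1 - polyGerm p :=
      map_sub polyGermHom _ _
    have h2 : termGerm β 1 - polyGerm p = (termGerm β 1 - polyGerm p - h) + h := by ring
    rw [h1, h2]
    have hh' := closure_boundedMultiples_le_span _ β hh
    rw [Ideal.span_eq] at hh'
    exact add_mem (hk hfp) hh'
  · rw [MvPolynomial.coeff_sub, MvPolynomial.coeff_monomial, if_pos rfl, hpβ, sub_zero]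
  · rw [MvPolynomial.coeff_sub, MvPolynomial.coeff_monomial, if_neg hne.symm, zero_sub,
      neg_ne_zero] at hα
    exact ⟨(hp α hα).1, (hp α hα).2.resolve_left hne⟩

/-! ### Existence and uniqueness of reduced standard bases -/

theorem exists_reducedStandardBasis (hr : IsLocalOrder r) {I : Ideal SmoothGerm}
    (hI : FiniteCodimension I) :
    ∃ G : Finset SmoothGerm, IsReducedStandardBasis r I G ∧ ∀ g ∈ G, IsPolynomialGerm g := by
  classical
  have hex : ∀ β, ∃ p : MvPolynomial (Fin 2) ℝ, β ∈ leadExpos r I → polyGerm p ∈ I ∧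
      p.coeff β = 1 ∧ ∀ α, p.coeff α ≠ 0 → α ≠ β → α ∉ leadExpos r I ∧ r α β := by
    intro β
    by_cases hβ : β ∈ leadExpos r I
    · obtain ⟨p, hp⟩ := exists_reduced_polynomial hr hI hβ
      exact ⟨p, fun _ => hp⟩
    · exact ⟨0, fun h => absurd h hβ⟩
  choose P hP using hex
  have hlead : ∀ β ∈ leadExpos r I, IsLeadExpo r (polyGerm (P β)) β := by
    intro β hβ
    refine ⟨by rw [taylorCoeff_polyGerm, (hP β hβ).2.1]; exact one_ne_zero, fun α hα hne => ?_⟩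
    rw [taylorCoeff_polyGerm] at hα
    exact ((hP β hβ).2.2 α hα hne).2
  set B : Set Expo := {β | Minimal (· ∈ leadExpos r I) β} with hB
  -- Minimal exponents form an antichain, finite by Dickson's lemma.
  have hfin : B.Finite := WellQuasiOrderedLE.finite_of_isAntichain
    fun α hα β hβ hne hle => hne (le_antisymm hle (hβ.2 hα.1 hle))
  set G : Finset SmoothGerm := hfin.toFinset.image fun β => polyGerm (P β) with hG
  have hmem : ∀ g, g ∈ G ↔ ∃ β ∈ B, polyGerm (P β) = g := by
    intro g
    rw [hG, Finset.mem_image]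
    simp only [Set.Finite.mem_toFinset]
  have hGI : (G : Set SmoothGerm) ⊆ I := by
    intro g hg
    obtain ⟨β, hβ, rfl⟩ := (hmem g).1 hg
    exact (hP β hβ.1).1
  have hcov : CoversLeadExpos r I G := by
    intro α hα
    obtain ⟨β, hle, hβ⟩ := exists_minimal_le_of_wellFoundedLT (· ∈ leadExpos r I) α hα
    exact ⟨_, (hmem _).2 ⟨β, hβ, rfl⟩, β, hlead β hβ.1, hle⟩
  refine ⟨G, ⟨⟨hcov.span_eq hr hI hGI, hcov.leadIdeal_eq hr hGI⟩, ?_, ?_⟩, ?_⟩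
  · intro g hg
    obtain ⟨β, hβ, rfl⟩ := (hmem g).1 hg
    rw [(hlead β hβ.1).leadCoeff_eq hr, taylorCoeff_polyGerm, (hP β hβ.1).2.1]
  -- A non-leading term of a basis element lies outside LT(I), so no leading monomial divides it; a
  -- leading one is minimal, so it is divisible only by itself.
  · rintro g hg h hh t ⟨α, hα, rfl⟩ hne hdvd
    obtain ⟨β, hβ, rfl⟩ := (hmem g).1 hg
    obtain ⟨β', hβ', rfl⟩ := (hmem h).1 hh
    obtain ⟨γ, hγ, hle⟩ := (leadTerm_dvd_termGerm_iff hr hα).1 hdvd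
    obtain rfl := hγ.unique hr (hlead β hβ.1)
    by_cases hαβ : α = β'
    · subst hαβ
      obtain rfl := le_antisymm hle (hβ'.2 hβ.1 hle)
      exact hne ⟨rfl, ((hlead γ hβ.1).leadTerm_eq hr).symm⟩
    · rw [taylorCoeff_polyGerm] at hα
      exact ((hP β' hβ'.1).2.2 α hα hαβ).1 (leadExpos_of_le hr hβ.1 hle)
  · intro g hg
    obtain ⟨β, -, rfl⟩ := (hmem g).1 hg
    exact ⟨_, rfl⟩

theorem IsReducedStandardBasis.exists_isLeadExpo {I : Ideal SmoothGerm} {G : Finset SmoothGerm}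
    (hG : IsReducedStandardBasis r I G) {g : SmoothGerm} (hg : g ∈ G) :
    ∃ α, IsLeadExpo r g α := by
  by_contra h
  have := hG.leadCoeff_eq_one g hg
  rw [leadCoeff_eq_zero h] at this
  exact zero_ne_one this

/-- In a reduced standard basis, the only exponent of `g` in `LT(I)` is the leading one. -/
theorem IsReducedStandardBasis.eq_of_mem_leadExpos (hr : IsLocalOrder r) {I : Ideal SmoothGerm}
    {G : Finset SmoothGerm} (hG : IsReducedStandardBasis r I G) {g : SmoothGerm} (hg : g ∈ G)
    {γ : Expo} (hγ : IsLeadExpo r g γ) {α : Expo} (hα : taylorCoeff g α ≠ 0)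
    (hL : α ∈ leadExpos r I) : α = γ := by
  obtain ⟨g', hg', δ, hδ, hle⟩ := hG.coversLeadExpos hr α hL
  by_contra hne
  refine hG.reduced g' hg' g hg _ ⟨α, hα, rfl⟩ ?_
    ((leadTerm_dvd_termGerm_iff hr hα).2 ⟨δ, hδ, hle⟩)
  rintro ⟨rfl, h⟩
  have h' := congrArg (fun u => taylorCoeff u α) h
  simp only [hγ.leadTerm_eq hr, taylorCoeff_termGerm, if_true, if_neg (Ne.symm hne)] at h'
  exact hα h'

/-- Reducedness forces the leading monomial of `g` to occur in `H` too. Two monic elements sharing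
it differ by an element of `I` with no exponent in LT(I). -/
theorem IsReducedStandardBasis.exists_infJet_eq (hr : IsLocalOrder r) {I : Ideal SmoothGerm}
    {G H : Finset SmoothGerm} (hG : IsReducedStandardBasis r I G)
    (hH : IsReducedStandardBasis r I H) {g : SmoothGerm} (hg : g ∈ G) :
    ∃ h ∈ H, infJet h = infJet g := by
  obtain ⟨γ, hγ⟩ := hG.exists_isLeadExpo hg
  obtain ⟨h, hh, δ, hδ, hle⟩ := hH.coversLeadExpos hr γ ⟨g, hG.subset hg, hγ⟩
  obtain ⟨g', hg', ε, hε, hle'⟩ := hG.coversLeadExpos hr δ ⟨h, hH.subset hh, hδ⟩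
  -- The leading monomial of `g'` divides that of `h`, which divides that of `g`; reducedness of `G`
  -- closes the circle, so all three agree.
  have hgg : g' = g := by
    by_contra hne
    exact hG.reduced g' hg' g hg _ ⟨γ, hγ.1, rfl⟩ (fun h => hne h.1)
      ((leadTerm_dvd_termGerm_iff hr hγ.1).2 ⟨ε, hε, hle'.trans hle⟩)
  subst hgg
  obtain rfl := hε.unique hr hγ
  obtain rfl := le_antisymm hle hle'
  refine ⟨h, hh, ?_⟩
  have hflat : IsFlat (h - g') := by
    refine isFlat_of_forall_notMem_leadExpos hr (sub_mem (hH.subset hh) (hG.subset hg))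
      fun α hα hL => ?_
    have hαδ : α = δ := by
      by_cases h0 : taylorCoeff g' α = 0
      · refine hH.eq_of_mem_leadExpos hr hh hδ (fun h1 => hα ?_) hL
        rw [taylorCoeff_sub, h0, h1, sub_zero]
      · exact hG.eq_of_mem_leadExpos hr hg hγ h0 hL
    subst hαδ
    rw [taylorCoeff_sub, ← hδ.leadCoeff_eq hr, ← hγ.leadCoeff_eq hr, hH.leadCoeff_eq_one h hh,
      hG.leadCoeff_eq_one g' hg, sub_self] at hα
    exact hα rfl
  change jet (h - g') = 0 at hflat
  rwa [map_sub, sub_eq_zero] at hflat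

theorem IsReducedStandardBasis.infJet_image_eq (hr : IsLocalOrder r) {I : Ideal SmoothGerm}
    {G H : Finset SmoothGerm} (hG : IsReducedStandardBasis r I G)
    (hH : IsReducedStandardBasis r I H) :
    infJet '' (G : Set SmoothGerm) = infJet '' (H : Set SmoothGerm) := by
  apply Set.Subset.antisymm
  · rintro _ ⟨g, hg, rfl⟩
    exact hG.exists_infJet_eq hr hH hg
  · rintro _ ⟨g, hg, rfl⟩
    exact hH.exists_infJet_eq hr hG hg

theorem IsPolynomialGerm.eq_of_infJet_eq {g h : SmoothGerm} (hg : IsPolynomialGerm g)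
    (hh : IsPolynomialGerm h) (heq : infJet g = infJet h) : g = h := by
  obtain ⟨p, rfl⟩ := hg
  obtain ⟨q, rfl⟩ := hh
  refine congrArg polyGerm (polyGerm_injective_of_flat ?_)
  change jet (polyGerm p - polyGerm q) = 0
  rw [map_sub, sub_eq_zero]
  exact heq

theorem IsReducedStandardBasis.subset_of_polynomial (hr : IsLocalOrder r) {I : Ideal SmoothGerm}
    {G H : Finset SmoothGerm} (hG : IsReducedStandardBasis r I G)
    (hH : IsReducedStandardBasis r I H) (hGp : ∀ g ∈ G, IsPolynomialGerm g)
    (hHp : ∀ g ∈ H, IsPolynomialGerm g) : G ⊆ H := by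
  intro g hg
  obtain ⟨h, hh, heq⟩ := hG.exists_infJet_eq hr hH hg
  rwa [← (hHp h hh).eq_of_infJet_eq (hGp g hg) heq]

end NormalForm

/-! The anti-graded lexicographic order. -/

theorem lexLT_iff {α β : Expo} : lexLT α β ↔ α 0 < β 0 ∨ (α 0 = β 0 ∧ α 1 < β 1) := by
  simp [lexLT, Fin.exists_fin_two]

theorem degree_expo (α : Expo) : α.degree = α 0 + α 1 := by
  rw [Finsupp.degree_eq_sum, Fin.sum_univ_two]

theorem expo_ext_iff {α β : Expo} : α = β ↔ α 0 = β 0 ∧ α 1 = β 1 := by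
  rw [Finsupp.ext_iff, Fin.forall_fin_two]

theorem alexLT_iff {α β : Expo} : alexLT α β ↔ β 0 + β 1 < α 0 + α 1 ∨
    (α 0 + α 1 = β 0 + β 1 ∧ (α 0 < β 0 ∨ (α 0 = β 0 ∧ α 1 < β 1))) := by
  rw [alexLT, lexLT_iff, degree_expo, degree_expo]

theorem isLocalOrder_alexLT : IsLocalOrder alexLT where
  strictTotal :=
    { trichotomous := fun α β h h' => by
        rw [alexLT_iff] at h h'
        rw [expo_ext_iff]
        omega
      irrefl := fun α h => by
        rw [alexLT_iff] at h
        omega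
      trans := fun α β γ h h' => by
        rw [alexLT_iff] at h h' ⊢
        omega }
  add_right α β γ h := by
    rw [alexLT_iff] at h ⊢
    simp only [Finsupp.add_apply]
    omega
  var_lt_one i := by
    rw [alexLT_iff]
    fin_cases i <;> simp

/-! ### Existence, uniqueness and degree of remainders -/

section AlexRemainder

variable {I : Ideal SmoothGerm} {G : Finset SmoothGerm}

/-- Here LT(f) = 0, so every `q g * g` must be flat. This is possible because the flat ideal lies in
its own product with `maxIdeal ^ k`, hence in its product with `I`. -/
theorem isRemainder_zero_of_isFlat (hI : FiniteCodimension I)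
    {r : Expo → Expo → Prop} (hG : IsStandardBasis r I G) {f : SmoothGerm} (hf : IsFlat f) :
    IsRemainder r f G (polyGerm 0) := by
  obtain ⟨k, hk⟩ := hI
  have hmem : f ∈ flatIdeal * Ideal.span (G : Set SmoothGerm) := by
    rw [hG.span_eq, mul_comm]
    exact Ideal.mul_mono hk le_rfl (flatIdeal_le_maxIdeal_pow_mul k (mem_flatIdeal.2 hf))
  obtain ⟨q, hq, rfl⟩ := exists_sum_of_mem_mul_span hmem
  refine ⟨⟨q, fun g _ α hα => ?_, by rw [polyGerm_zero, sub_self]⟩, ?_⟩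
  · exact absurd (isFlat_iff.1 (mem_flatIdeal.1 (flatIdeal.mul_mem_right g (hq g))) α) hα.1
  · rintro _ ⟨α, hα, rfl⟩
    rw [polyGerm_zero, taylorCoeff_zero] at hα
    exact absurd rfl hα

theorem exists_isRemainder_of_not_isFlat (hI : FiniteCodimension I)
    (hG : IsStandardBasis alexLT I G) {f : SmoothGerm} (hf : ¬ IsFlat f) :
    ∃ p : MvPolynomial (Fin 2) ℝ, IsRemainder alexLT f G (polyGerm p) := by
  have hr := isLocalOrder_alexLT
  obtain ⟨k, hk⟩ := hI
  -- The precision `β.degree + 1 + k` splits: `maxIdeal ^ k` is absorbed by `I`, and the other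
  -- factor puts the correcting quotients in `maxIdeal ^ (β.degree + 1)`.
  obtain ⟨β, hβ⟩ := hr.exists_isLeadExpo hf
  have hcov := hG.coversLeadExpos hr
  obtain ⟨p, hp, h, hh, hfp⟩ := exists_normalForm hr hcov (β.degree + 1 + k) (β := β) f
    fun α hα _ => by
      by_cases hne : α = β
      · exact Or.inl hne
      · exact Or.inr (hβ.2 α hα hne)
  obtain ⟨q, rfl, hq⟩ := exists_sum_of_mem_closure_boundedMultiples hh
  rw [pow_add] at hfp
  have hfp' : f - polyGerm p - ∑ g ∈ G, q g * g ∈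
      maxIdeal ^ (β.degree + 1) * Ideal.span (G : Set SmoothGerm) := by
    rw [hG.span_eq]
    exact Ideal.mul_mono le_rfl hk hfp
  obtain ⟨q', hq', hsum⟩ := exists_sum_of_mem_mul_span hfp'
  refine ⟨p, ⟨fun g => q g + q' g, fun g hg α hα => ⟨β, hβ, ?_⟩, ?_⟩,
    (forall_notMem_leadExpos_iff hr hcov (fun g hg => hG.subset hg) _).2 fun α hα => ?_⟩
  · have hne := hα.1
    rw [add_mul, taylorCoeff_add] at hne
    by_cases h0 : taylorCoeff (q g * g) α = 0
    · rw [h0, zero_add] at hne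
      -- The correction `q' g * g` has only exponents of degree above `β.degree`, which are below
      -- `β` because the order compares degrees first. A general local order gives no such
      -- conclusion.
      refine Or.inr (Or.inl ?_)
      by_contra hdeg
      exact hne (mem_maxIdeal_pow.1 (Ideal.mul_mem_right g _ (hq' g)) α (by omega))
    · exact hq g hg α h0
  · simp only [add_mul, Finset.sum_add_distrib, ← hsum]
    ring
  · rw [taylorCoeff_polyGerm] at hα
    exact (hp α hα).1

theorem IsRemainder.sub_mem {r : Expo → Expo → Prop} (hG : IsStandardBasis r I G)
    {f s : SmoothGerm} (hs : IsRemainder r f G s) : f - s ∈ I := by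
  obtain ⟨⟨q, -, rfl⟩, -⟩ := hs
  rw [sub_sub_cancel]
  exact I.sum_mem fun g hg => I.mul_mem_left _ (hG.subset hg)

theorem IsRemainder.notMem_leadExpos {r : Expo → Expo → Prop} (hr : IsLocalOrder r)
    (hG : IsStandardBasis r I G) {f s : SmoothGerm} (hs : IsRemainder r f G s) {α : Expo}
    (hα : taylorCoeff s α ≠ 0) : α ∉ leadExpos r I :=
  (forall_notMem_leadExpos_iff hr (hG.coversLeadExpos hr) (fun _ hg => hG.subset hg) s).1
    hs.2 α hα

/-- Any two remainders of a germ differ by a flat germ. -/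
theorem IsRemainder.isFlat_sub {r : Expo → Expo → Prop} (hr : IsLocalOrder r)
    (hG : IsStandardBasis r I G) {f s s' : SmoothGerm} (hs : IsRemainder r f G s)
    (hs' : IsRemainder r f G s') : IsFlat (s - s') := by
  have hmem : s - s' ∈ I := by
    have : s - s' = (f - s') - (f - s) := by ring
    rw [this]
    exact Ideal.sub_mem _ (hs'.sub_mem hG) (hs.sub_mem hG)
  refine isFlat_of_forall_notMem_leadExpos hr hmem fun α hα => ?_
  by_cases h : taylorCoeff s α = 0
  · refine hs'.notMem_leadExpos hr hG fun h' => hα ?_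
    rw [taylorCoeff_sub, h, h', sub_zero]
  · exact hs.notMem_leadExpos hr hG h

/-- Every monomial of degree above `k` belongs to LT(I), so none can occur in a remainder. -/
theorem IsRemainder.totalDegree_le {r : Expo → Expo → Prop} (hr : IsLocalOrder r)
    (hG : IsStandardBasis r I G) {f : SmoothGerm} {p : MvPolynomial (Fin 2) ℝ}
    (hp : IsRemainder r f G (polyGerm p)) {k : ℕ} (hk : maxIdeal ^ (k + 1) ≤ I) :
    p.totalDegree ≤ k := by
  refine Finset.sup_le fun α hα => ?_
  rw [MvPolynomial.mem_support_iff, ← taylorCoeff_polyGerm] at hα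
  have h : α.degree ≤ k := by
    by_contra h
    exact hp.notMem_leadExpos hr hG hα (mem_leadExpos_of_le_degree hk (by omega))
  exact h

end AlexRemainder

theorem mainTheorem4 (I : Ideal SmoothGerm) (hI : FiniteCodimension I) :
    (∀ r : Expo → Expo → Prop, IsLocalOrder r →
      (∃! G : Finset SmoothGerm,
        IsReducedStandardBasis r I G ∧ ∀ g ∈ G, IsPolynomialGerm g) ∧
      (∀ G H : Finset SmoothGerm,
        IsReducedStandardBasis r I G → IsReducedStandardBasis r I H →
          infJet '' (G : Set SmoothGerm) = infJet '' (H : Set SmoothGerm))) ∧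
    (∀ G : Finset SmoothGerm, IsStandardBasis alexLT I G → ∀ f : SmoothGerm,
      ∃ p : MvPolynomial (Fin 2) ℝ,
        IsRemainder alexLT f G (polyGerm p) ∧
        (∀ p' : MvPolynomial (Fin 2) ℝ, IsRemainder alexLT f G (polyGerm p') → p' = p) ∧
        (∀ s : SmoothGerm, IsRemainder alexLT f G s → IsFlat (s - polyGerm p)) ∧
        (∀ k : ℕ, maxIdeal ^ (k + 1) ≤ I → p.totalDegree ≤ k)) := by
  refine ⟨fun r hr => ⟨?_, fun G H hG hH => hG.infJet_image_eq hr hH⟩, fun G hG f => ?_⟩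
  · obtain ⟨G, hG, hGp⟩ := exists_reducedStandardBasis hr hI
    refine ⟨G, ⟨hG, hGp⟩, fun H ⟨hH, hHp⟩ => ?_⟩
    exact Finset.Subset.antisymm (hH.subset_of_polynomial hr hG hHp hGp)
      (hG.subset_of_polynomial hr hH hGp hHp)
  · have hr := isLocalOrder_alexLT
    obtain ⟨p, hp⟩ : ∃ p : MvPolynomial (Fin 2) ℝ, IsRemainder alexLT f G (polyGerm p) := by
      by_cases hf : IsFlat f
      · exact ⟨0, isRemainder_zero_of_isFlat hI hG hf⟩
      · exact exists_isRemainder_of_not_isFlat hI hG hf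
    exact ⟨p, hp, fun p' hp' => polyGerm_injective_of_flat (hp'.isFlat_sub hr hG hp),
      fun s hs => hs.isFlat_sub hr hG hp, fun k hk => hp.totalDegree_le hr hG hk⟩
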